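/- Oriented virtual links are equivalence classes of oriented virtual link diagrams in the plane under the generalized Reidemeister moves. Let $K$ be a virtual knot or link, and let $D$ be a diagram of $K$ with $n$ short arcs, a short arc running from one (classical or virtual) crossing to the next one. The virtual knot group $VG_K$ is generated by the short arcs together with two further generators $s,q$, subject to $[s,q]=1$ and to two relations for each crossing. Draw the crossing with both strands directed upwards. At a positive crossing with incoming overpassing arc $x$ and incoming underpassing arc $y$, the outgoing over- and underpassing arcs are $sxs^{-1}$ and $xysx^{-1}s^{-1}$; at a negative crossing the inverse rule holds, that is, the outgoing arcs are $s^{-1}xs$ and $s^{-1}x^{-1}s\,y\,x$; at a virtual crossing with incoming arcs $l$ (bottom left) and $r$ (bottom right), the outgoing arcs are $q^{-1}rq$ (top left) and $qlq^{-1}$ (top right). The virtual Alexander polynomial $H_K(s,t,q)\in\mathbb Z[s^{\pm1},t^{\pm1},q^{\pm1}]$ is the greatest common divisor of the $(n+1)\times(n+1)$ minors of the matrix of Fox derivatives of these relations with respect to all $n+2$ generators, evaluated by sending every short arc to $t$. The generalized Alexander polynomial $G_K(s,t)\in\mathbb Z[s^{\pm1},t^{\pm1}]$ is the determinant of the presentation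 matrix of the Alexander biquandle of $D$ over $\mathbb Z[s^{\pm1},t^{\pm1}]$: its generators are the arcs, with outgoing overpassing arc $sx$ and outgoing underpassing arc $(1-st)x+ty$ at a positive crossing, the inverse rule at a negative crossing, and labels passing unchanged through virtual crossings. (A component without crossings counts as one arc with the trivial relation.) Both polynomials are taken up to multiplication by units, and $\doteq$ denotes equality up to multiplication by a unit of the Laurent polynomial ring in question. Then, for every virtual knot or link $K$, both polynomials exist, and whichever diagrams of $K$ they are computed from, $$H_K(s,t,q)\doteq G_K(sq^{-1},tq)\quad\text{and}\quad G_K(s,t)\doteq H_K(s,t,1).$$ Consequently the two invariants carry the same information: for all virtual knots or links $K,K'$ one has $H_K\doteq H_{K'}$ if and only if $G_K\doteq G_{K'}$. -/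

import Mathlib

noncomputable section

/-! ### Laurent polynomials -/

/-- The ring `ℤ[x₀^{±1}, …, x_{n-1}^{±1}]` of Laurent polynomials, as the integral group ring of
`ℤⁿ`. -/
abbrev Laurent (n : ℕ) : Type := AddMonoidAlgebra ℤ (Fin n → ℤ)

namespace Laurent

/-- The `i`-th variable, as a unit. -/
def X {n : ℕ} (i : Fin n) : (Laurent n)ˣ :=
  Units.map (AddMonoidAlgebra.of ℤ (Fin n → ℤ)) (toUnits (Multiplicative.ofAdd (Pi.single i 1)))

/-- The monomial `∏ uᵢ ^ eᵢ` in given units `u`, as a homomorphism in the exponent vector `e`. -/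
def monomialHom {n : ℕ} {R : Type} [CommRing R] (u : Fin n → Rˣ) :
    Multiplicative (Fin n → ℤ) →* Rˣ where
  toFun e := ∏ i, u i ^ (Multiplicative.toAdd e i)
  map_one' := by simp
  map_mul' a b := by simp [zpow_add, Finset.prod_mul_distrib]

/-- Substitution `p ↦ p(u₀, …, u_{n-1})` of units for the variables. -/
def subst {n : ℕ} {R : Type} [CommRing R] (u : Fin n → Rˣ) : Laurent n →+* R :=
  (AddMonoidAlgebra.lift ℤ R (Fin n → ℤ)
    ((Units.coeHom R).comp (monomialHom u))).toRingHom

theorem subst_X {n : ℕ} {R : Type} [CommRing R] (u : Fin n → Rˣ) (i : Fin n) :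
    subst u (X i : Laurent n) = u i := by
  simp only [subst, X, AlgHom.toRingHom_eq_coe, Units.coe_map,
    RingHom.coe_coe, val_toUnits_apply, AddMonoidAlgebra.lift_of, MonoidHom.comp_apply,
    Units.coeHom_apply, monomialHom, MonoidHom.coe_mk, OneHom.coe_mk, toAdd_ofAdd]
  rw [Finset.prod_eq_single i] <;> simp +contextual

end Laurent

/-- The ring `ℤ[s^{±1}, t^{±1}, q^{±1}]`. -/
abbrev LaurentSTQ : Type := Laurent 3

/-- The ring `ℤ[s^{±1}, t^{±1}]`. -/
abbrev LaurentST : Type := Laurent 2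

namespace LaurentSTQ

/-- The variable `s`. -/
def s : LaurentSTQˣ := Laurent.X 0
/-- The variable `t`. -/
def t : LaurentSTQˣ := Laurent.X 1
/-- The variable `q`. -/
def q : LaurentSTQˣ := Laurent.X 2

end LaurentSTQ

namespace LaurentST

/-- The variable `s`. -/
def s : LaurentSTˣ := Laurent.X 0
/-- The variable `t`. -/
def t : LaurentSTˣ := Laurent.X 1

end LaurentST

/-! ### Fox calculus and elementary ideals -/

namespace Fox

variable {γ : Type}

/-- The free group acting on (the additive group of) its integral group ring by left
multiplication. -/
def leftMul : FreeGroup γ →* MulAut (Multiplicative (MonoidAlgebra ℤ (FreeGroup γ))) where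
  toFun g :=
    { toFun := fun x => Multiplicative.ofAdd
        (MonoidAlgebra.of ℤ (FreeGroup γ) g * Multiplicative.toAdd x)
      invFun := fun x => Multiplicative.ofAdd
        (MonoidAlgebra.of ℤ (FreeGroup γ) g⁻¹ * Multiplicative.toAdd x)
      left_inv := fun x => by
        beta_reduce
        rw [toAdd_ofAdd, ← mul_assoc, ← map_mul, inv_mul_cancel, map_one, one_mul, ofAdd_toAdd]
      right_inv := fun x => by
        beta_reduce
        rw [toAdd_ofAdd, ← mul_assoc, ← map_mul, mul_inv_cancel, map_one, one_mul, ofAdd_toAdd]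
      map_mul' := fun x y => by rw [toAdd_mul, mul_add, ofAdd_add] }
  map_one' := by
    ext1 x
    simp only [MulEquiv.coe_mk, Equiv.coe_fn_mk, map_one, one_mul, ofAdd_toAdd, MulAut.one_apply]
  map_mul' g h := by
    ext1 x
    simp only [MulAut.mul_apply, MulEquiv.coe_mk, Equiv.coe_fn_mk, toAdd_ofAdd, map_mul, mul_assoc]

variable [DecidableEq γ]

/-- The homomorphism `w ↦ (∂w/∂x_j, w)` into the semidirect product `ℤ[F] ⋊ F`. -/
def magnus (j : γ) : FreeGroup γ →*
    Multiplicative (MonoidAlgebra ℤ (FreeGroup γ)) ⋊[leftMul] FreeGroup γ :=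
  FreeGroup.lift fun i => ⟨Multiplicative.ofAdd (if i = j then 1 else 0), FreeGroup.of i⟩

/-- The Fox derivative `∂w/∂x_j ∈ ℤ[F]`: the unique map with `∂x_i/∂x_j = δ_ij` and
`∂(uv)/∂x_j = ∂u/∂x_j + u ∂v/∂x_j`; see `Fox.deriv_of` and `Fox.deriv_mul`. -/
def deriv (j : γ) (w : FreeGroup γ) : MonoidAlgebra ℤ (FreeGroup γ) :=
  Multiplicative.toAdd (magnus j w).left

theorem magnus_right (j : γ) (w : FreeGroup γ) : (magnus j w).right = w := by
  have h : (SemidirectProduct.rightHom.comp (magnus j)) = MonoidHom.id (FreeGroup γ) := by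
    ext i; simp [magnus]
  exact DFunLike.congr_fun h w

theorem deriv_of (j i : γ) : deriv j (FreeGroup.of i) = if i = j then 1 else 0 := by
  simp [deriv, magnus]

theorem deriv_mul (j : γ) (u v : FreeGroup γ) :
    deriv j (u * v) = deriv j u + MonoidAlgebra.of ℤ (FreeGroup γ) u * deriv j v := by
  simp only [deriv, map_mul, SemidirectProduct.mul_left, magnus_right, toAdd_mul]
  rfl

/-- The Alexander matrix of a presentation with generators `γ` and relators `r`, relative to the
homomorphism `x_g ↦ a g` of the free group to the units of a commutative ring: the images in the
ring of the Fox derivatives `∂r_i/∂x_g`. -/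
def alexanderMatrix {ρ R : Type} [CommRing R] (a : γ → Rˣ) (r : ρ → FreeGroup γ) :
    Matrix ρ γ R :=
  Matrix.of fun i g => MonoidAlgebra.lift ℤ R (FreeGroup γ)
    ((Units.coeHom R).comp (FreeGroup.lift a)) (deriv g (r i))

end Fox

/-- The ideal generated by the `k × k` minors of a matrix. -/
def minorIdeal {ρ γ R : Type} [CommRing R] (M : Matrix ρ γ R) (k : ℕ) : Ideal R :=
  Ideal.span (Set.range fun c : (Fin k → ρ) × (Fin k → γ) => (M.submatrix c.1 c.2).det)

/-- `f` generates the smallest principal ideal containing `I`, i.e. `f` is a greatest common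
divisor of the elements of `I`. -/
def GeneratesPrincipalHull {R : Type} [CommRing R] (I : Ideal R) (f : R) : Prop :=
  IsLeast {J : Ideal R | J.IsPrincipal ∧ I ≤ J} (Ideal.span {f})

/-! ### Virtual link diagrams -/

/-- The kind of a double point: positive or negative classical, or virtual. -/
inductive CrossingKind
  | pos | neg | virt
  deriving DecidableEq

/-- The left and the right side of a crossing, drawn with both strands directed upwards. -/
inductive Side
  | left | right
  deriving DecidableEq

instance : Fintype Side where
  elems := {.left, .right}
  complete := by rintro (_ | _) <;> decide

instance : Fintype CrossingKind where
  elems := {.pos, .neg, .virt}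
  complete := by rintro (_ | _ | _) <;> decide

/-- The other side. -/
def Side.other : Side → Side
  | .left => .right
  | .right => .left

/-- The kind with the roles of over- and underpass exchanged. -/
def CrossingKind.opp : CrossingKind → CrossingKind
  | .pos => .neg
  | .neg => .pos
  | .virt => .virt

/-- The combinatorial data of an oriented link diagram on an oriented surface, as a graph whose
vertices are the double points (*crossings*) and finitely many marked *points* on the strands
(needed only to record components without crossings).

Draw every crossing with both strands directed upwards.  It then has a left and a right incoming
arc end at the bottom, and a left and a right outgoing arc end at the top; the two strands run from
bottom left to top right and from bottom right to top left.  The first of these is the overpassing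
one at a positive crossing, the second one at a negative crossing.  A marked point has one incoming
and one outgoing arc end.  So the incoming arc ends, and likewise the outgoing ones, are indexed by
`(Crossing × Side) ⊕ Point`; the bijection `next` sends the outgoing end at which an arc starts to
the incoming end at which it terminates. -/
structure Diagram where
  Crossing : Type
  Point : Type
  [fintypeCrossing : Fintype Crossing]
  [decEqCrossing : DecidableEq Crossing]
  [fintypePoint : Fintype Point]
  [decEqPoint : DecidableEq Point]
  kind : Crossing → CrossingKind
  next : ((Crossing × Side) ⊕ Point) ≃ ((Crossing × Side) ⊕ Point)

namespace Diagram

attribute [instance] fintypeCrossing decEqCrossing fintypePoint decEqPoint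

/-- The index set of the incoming, and of the outgoing, arc ends.  Arcs are named by the incoming
end at which they terminate: the arc `p` terminates at `p`, and the arc starting at the outgoing
end `p` is `next p`. -/
abbrev Port (D : Diagram) : Type := (D.Crossing × Side) ⊕ D.Point

/-! #### Planarity -/

/-- The half-edges of the underlying graph: `inl p` is the incoming end `p` and `inr p` the outgoing
end `p`. -/
abbrev HalfEdge (D : Diagram) : Type := D.Port ⊕ D.Port

/-- The counterclockwise rotation of the half-edges around each vertex; at a crossing: top right,
top left, bottom left, bottom right. -/
def rotation (D : Diagram) : Equiv.Perm D.HalfEdge where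
  toFun
    | .inr (.inl (c, .right)) => .inr (.inl (c, .left))
    | .inr (.inl (c, .left)) => .inl (.inl (c, .left))
    | .inl (.inl (c, .left)) => .inl (.inl (c, .right))
    | .inl (.inl (c, .right)) => .inr (.inl (c, .right))
    | .inl (.inr x) => .inr (.inr x)
    | .inr (.inr x) => .inl (.inr x)
  invFun
    | .inr (.inl (c, .left)) => .inr (.inl (c, .right))
    | .inl (.inl (c, .left)) => .inr (.inl (c, .left))
    | .inl (.inl (c, .right)) => .inl (.inl (c, .left))
    | .inr (.inl (c, .right)) => .inl (.inl (c, .right))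
    | .inr (.inr x) => .inl (.inr x)
    | .inl (.inr x) => .inr (.inr x)
  left_inv := by rintro ((⟨c, _ | _⟩ | x) | (⟨c, _ | _⟩ | x)) <;> rfl
  right_inv := by rintro ((⟨c, _ | _⟩ | x) | (⟨c, _ | _⟩ | x)) <;> rfl

/-- The involution exchanging the two ends of each arc. -/
def flip (D : Diagram) : Equiv.Perm D.HalfEdge where
  toFun
    | .inr p => .inl (D.next p)
    | .inl p => .inr (D.next.symm p)
  invFun
    | .inr p => .inl (D.next p)
    | .inl p => .inr (D.next.symm p)
  left_inv := by rintro (p | p) <;> simp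
  right_inv := by rintro (p | p) <;> simp

/-- The number of faces: the boundary of a face is a cycle of `rotation * flip`. -/
def numFaces (D : Diagram) : ℕ :=
  Nat.card (MulAction.orbitRel.Quotient (Subgroup.zpowers (D.rotation * D.flip)) D.HalfEdge)

/-- The number of connected components of the underlying graph. -/
def numComponents (D : Diagram) : ℕ :=
  Nat.card (MulAction.orbitRel.Quotient (Subgroup.closure {D.rotation, D.flip}) D.HalfEdge)

/-- The diagram is a diagram in the plane (equivalently, on the sphere), i.e. all components of the
underlying graph with rotations have genus zero: `V - E + F = 2 C` by Euler's formula.  As each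
component has `V - E + F ≤ 2`, the sum over all components can be used. -/
def IsPlanar (D : Diagram) : Prop :=
  Fintype.card D.Crossing + Fintype.card D.Point + D.numFaces =
    Fintype.card D.Port + 2 * D.numComponents

/-! #### The virtual knot group and the virtual Alexander polynomial -/

/-- Generators of the virtual knot group: the arcs, `s` and `q`. -/
inductive Gen (D : Diagram)
  | arc (p : D.Port)
  | s
  | q
  deriving DecidableEq

/-- The label of the arc starting at an outgoing end, as a word in `s`, `q` and the labels of the
arcs terminating at the same vertex. -/
def label (D : Diagram) : D.Port → FreeGroup D.Gen
  | .inr x => FreeGroup.of (Gen.arc (.inr x))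
  | .inl (c, side) =>
    let s : FreeGroup D.Gen := FreeGroup.of Gen.s
    let q : FreeGroup D.Gen := FreeGroup.of Gen.q
    let l : FreeGroup D.Gen := FreeGroup.of (Gen.arc (.inl (c, .left)))
    let r : FreeGroup D.Gen := FreeGroup.of (Gen.arc (.inl (c, .right)))
    match D.kind c, side with
    | .pos, .left => l * r * s * l⁻¹ * s⁻¹
    | .pos, .right => s * l * s⁻¹
    | .neg, .left => s⁻¹ * r * s
    | .neg, .right => s⁻¹ * r⁻¹ * s * l * r
    | .virt, .left => q⁻¹ * r * q
    | .virt, .right => q * l * q⁻¹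

/-- Relators of the virtual knot group: two for each crossing, the identification of the two arcs
meeting at a marked point, and the commutator `[s, q]`. -/
def relator (D : Diagram) : D.Port ⊕ Unit → FreeGroup D.Gen
  | .inl p => FreeGroup.of (Gen.arc (D.next p)) * (D.label p)⁻¹
  | .inr _ =>
    FreeGroup.of Gen.s * FreeGroup.of Gen.q * (FreeGroup.of Gen.s)⁻¹ * (FreeGroup.of Gen.q)⁻¹

/-- The virtual knot group of the diagram. -/
abbrev VirtualKnotGroup (D : Diagram) : Type := PresentedGroup (Set.range D.relator)

/-- The images `s`, `t`, `q` of the generators under abelianization. -/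
def abel (D : Diagram) : D.Gen → LaurentSTQˣ
  | .arc _ => LaurentSTQ.t
  | .s => LaurentSTQ.s
  | .q => LaurentSTQ.q

/-- The `0`-th virtual elementary ideal: it is generated by the `(n+1) × (n+1)` minors of the
`(n+1) × (n+2)` matrix of Fox derivatives of the presentation of the virtual knot group, `n` being
the number of arcs. -/
def elementaryIdeal (D : Diagram) : Ideal LaurentSTQ :=
  minorIdeal (Fox.alexanderMatrix D.abel D.relator) (Fintype.card D.Port + 1)

/-- `H` is the virtual Alexander polynomial computed from the diagram: the greatest common divisor
of the generators of the `0`-th elementary ideal.  It is unique up to units. -/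
def IsVirtualAlexanderPolynomial (D : Diagram) (H : LaurentSTQ) : Prop :=
  GeneratesPrincipalHull D.elementaryIdeal H

/-! #### The generalized Alexander polynomial -/

/-- The rule of the Alexander biquandle, over `ℤ[s^{±1}, t^{±1}]`: the arc leaving a vertex as a
linear combination of the arcs entering it.  At a positive crossing, if `x` is the incoming
overpassing and `y` the incoming underpassing arc, the outgoing ones are `s x` and
`(1 - s t) x + t y`; a negative crossing has the inverse rule, and virtual crossings and marked
points are ignored, i.e. the labels pass straight through. -/
def biquandleRule (D : Diagram) : D.Port → (D.Port → LaurentST)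
  | .inr x => Pi.single (.inr x) 1
  | .inl (c, side) =>
    let s : LaurentSTˣ := LaurentST.s
    let t : LaurentSTˣ := LaurentST.t
    let l : D.Port → LaurentST := Pi.single (.inl (c, .left)) 1
    let r : D.Port → LaurentST := Pi.single (.inl (c, .right)) 1
    match D.kind c, side with
    | .pos, .left => (1 - (s : LaurentST) * t) • l + (t : LaurentST) • r
    | .pos, .right => (s : LaurentST) • l
    | .neg, .left => (↑s⁻¹ : LaurentST) • r
    | .neg, .right => (1 - (↑s⁻¹ : LaurentST) * ↑t⁻¹) • r + (↑t⁻¹ : LaurentST) • l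
    | .virt, .left => r
    | .virt, .right => l

/-- The square presentation matrix of the Alexander biquandle module of the diagram: generators are
the arcs, and the relations say that each arc is given by the Alexander biquandle rule at the vertex
where it starts. -/
def biquandleMatrix (D : Diagram) : Matrix D.Port D.Port LaurentST :=
  Matrix.of fun p => Pi.single (D.next p) 1 - D.biquandleRule p

/-- `G` is the generalized Alexander polynomial computed from the diagram: up to units, the
determinant of the presentation matrix of the Alexander biquandle. -/
def IsGeneralizedAlexanderPolynomial (D : Diagram) (G : LaurentST) : Prop :=
  Associated G D.biquandleMatrix.det

/-! #### Isomorphisms and marked points -/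

/-- Isomorphism (relabelling) of diagrams. -/
def Iso (D E : Diagram) : Prop :=
  ∃ (c : D.Crossing ≃ E.Crossing) (x : D.Point ≃ E.Point),
    (∀ a, E.kind (c a) = D.kind a) ∧
    ∀ p, E.next (Sum.map (Prod.map c id) x p) = Sum.map (Prod.map c id) x (D.next p)

/-- Insert a new marked point on the arc that starts at the outgoing end `p`. -/
def subdivide (D : Diagram) (p : D.Port) : Diagram where
  Crossing := D.Crossing
  Point := D.Point ⊕ Unit
  kind := D.kind
  next :=
    let e : ((D.Crossing × Side) ⊕ (D.Point ⊕ Unit)) ≃ (D.Port ⊕ Unit) :=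
      (Equiv.sumAssoc _ _ _).symm
    e.trans ((Equiv.swap (.inl p) (.inr ())).trans
      ((Equiv.sumCongr D.next (Equiv.refl Unit)).trans e.symm))

end Diagram

/-! ### Tangles and generalized Reidemeister moves -/

/-- The combinatorial data of a tangle with `m` incoming and `m` outgoing boundary ends, with the
conventions of `Diagram`.  An arc starts at an outgoing end of a vertex or at an incoming boundary
end, and terminates at an incoming end of a vertex or at an outgoing boundary end. -/
structure Tangle (m : ℕ) where
  Crossing : Type
  Point : Type
  [fintypeCrossing : Fintype Crossing]
  [decEqCrossing : DecidableEq Crossing]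
  [fintypePoint : Fintype Point]
  [decEqPoint : DecidableEq Point]
  kind : Crossing → CrossingKind
  next : (((Crossing × Side) ⊕ Point) ⊕ Fin m) ≃ (((Crossing × Side) ⊕ Point) ⊕ Fin m)

namespace Tangle

attribute [instance] fintypeCrossing decEqCrossing fintypePoint decEqPoint

/-- Auxiliary reindexing for `glue`. -/
def glueEquiv (C P C' P' A B : Type) :
    (((C ⊕ C') × Side) ⊕ ((P ⊕ P') ⊕ (A ⊕ B))) ≃
      ((((C × Side) ⊕ P) ⊕ A) ⊕ (((C' × Side) ⊕ P') ⊕ B)) where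
  toFun
    | .inl (.inl c, a) => .inl (.inl (.inl (c, a)))
    | .inl (.inr c, a) => .inr (.inl (.inl (c, a)))
    | .inr (.inl (.inl x)) => .inl (.inl (.inr x))
    | .inr (.inl (.inr x)) => .inr (.inl (.inr x))
    | .inr (.inr (.inl k)) => .inl (.inr k)
    | .inr (.inr (.inr k)) => .inr (.inr k)
  invFun
    | .inl (.inl (.inl (c, a))) => .inl (.inl c, a)
    | .inr (.inl (.inl (c, a))) => .inl (.inr c, a)
    | .inl (.inl (.inr x)) => .inr (.inl (.inl x))
    | .inr (.inl (.inr x)) => .inr (.inl (.inr x))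
    | .inl (.inr k) => .inr (.inr (.inl k))
    | .inr (.inr k) => .inr (.inr (.inr k))
  left_inv := by rintro (⟨c | c, a⟩ | ((x | x) | (k | k))) <;> rfl
  right_inv := by rintro (((⟨c, a⟩ | x) | k) | ((⟨c, a⟩ | x) | k)) <;> rfl

/-- The diagram obtained by gluing two tangles along their boundaries: the outgoing boundary ends of
`T` are the incoming ones of `R` and vice versa.  The boundary ends become marked points,
`inr (inl k)` being the `k`-th incoming and `inr (inr k)` the `k`-th outgoing boundary end of `T`. -/
def glue {m : ℕ} (T R : Tangle m) : Diagram where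
  Crossing := T.Crossing ⊕ R.Crossing
  Point := (T.Point ⊕ R.Point) ⊕ (Fin m ⊕ Fin m)
  kind := Sum.elim T.kind R.kind
  next :=
    (glueEquiv _ _ _ _ (Fin m) (Fin m)).trans
      ((Equiv.sumCongr T.next R.next).trans
        ((glueEquiv _ _ _ _ (Fin m) (Fin m)).symm.trans
          (Equiv.sumCongr (Equiv.refl _)
            (Equiv.sumCongr (Equiv.refl _) (Equiv.sumComm (Fin m) (Fin m))))))

/-- A tangle with crossings `Fin n` and no marked points. -/
def ofNext {n m : ℕ} (kind : Fin n → CrossingKind)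
    (next : (Fin n × Side) ⊕ Fin m → (Fin n × Side) ⊕ Fin m)
    (h : Function.Bijective next) : Tangle m where
  Crossing := Fin n
  Point := Empty
  kind := kind
  next := (Equiv.sumCongr (Equiv.sumEmpty _ _) (Equiv.refl _)).trans
    ((Equiv.ofBijective next h).trans
      (Equiv.sumCongr (Equiv.sumEmpty _ _) (Equiv.refl _)).symm)

/-- `m` strands without crossings, the `i`-th one running from `i` to `i`. -/
def strands (m : ℕ) : Tangle m :=
  ofNext (n := 0) Fin.elim0 id Function.bijective_id

/-- A strand with one curl of the given kind, the loop being on the side `a` of the crossing. -/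
def curl (k : CrossingKind) (a : Side) : Tangle 1 :=
  ofNext (n := 1) (fun _ => k)
    (fun
      | .inl (_, b) => if b = a then .inl (0, a) else .inr 0
      | .inr _ => .inl (0, a.other))
    (by cases a <;> decide)

/-- Two parallel strands crossing each other twice. -/
def parallelBigon (k : CrossingKind) : Tangle 2 :=
  ofNext (n := 2) ![k, k.opp]
    (fun
      | .inr 0 => .inl (0, .left)
      | .inr 1 => .inl (0, .right)
      | .inl (0, a) => .inl (1, a)
      | .inl (1, .left) => .inr 0
      | .inl (1, .right) => .inr 1)
    (by decide)

/-- Two antiparallel strands crossing each other twice, the bigon between them being on the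
side `a` of both crossings. -/
def antiparallelBigon (k : CrossingKind) (a : Side) : Tangle 2 :=
  ofNext (n := 2) ![k, k.opp]
    (fun
      | .inr 0 => .inl (0, a.other)
      | .inr 1 => .inl (1, a.other)
      | .inl (0, b) => if b = a then .inl (1, a) else .inr 1
      | .inl (1, b) => if b = a then .inl (0, a) else .inr 0)
    (by cases a <;> decide)

/-- Three strands directed upwards, crossing pairwise: from the bottom to the top, first the two
on the left (crossing `0`), then the two on the right (crossing `1`), then the two on the left
(crossing `2`).  In terms of the strands `0`, `1`, `2`, numbered from left to right at the bottom,
these are the crossings of `0` and `1`, of `0` and `2`, and of `1` and `2`. -/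
def braidTriangleLeft (k : Fin 3 → CrossingKind) : Tangle 3 :=
  ofNext (n := 3) k
    (fun
      | .inr 0 => .inl (0, .left)
      | .inr 1 => .inl (0, .right)
      | .inr 2 => .inl (1, .right)
      | .inl (0, .left) => .inl (2, .left)
      | .inl (0, .right) => .inl (1, .left)
      | .inl (1, .left) => .inl (2, .right)
      | .inl (1, .right) => .inr 2
      | .inl (2, .left) => .inr 0
      | .inl (2, .right) => .inr 1)
    (by decide)

/-- The same three strands and crossings as in `braidTriangleLeft`, on the other side of the
triangle: first the two strands on the right cross, then the two on the left, then the two on the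
right. -/
def braidTriangleRight (k : Fin 3 → CrossingKind) : Tangle 3 :=
  ofNext (n := 3) k
    (fun
      | .inr 0 => .inl (1, .left)
      | .inr 1 => .inl (2, .left)
      | .inr 2 => .inl (2, .right)
      | .inl (2, .left) => .inl (1, .right)
      | .inl (2, .right) => .inl (0, .right)
      | .inl (1, .left) => .inr 0
      | .inl (1, .right) => .inl (0, .left)
      | .inl (0, .left) => .inr 1
      | .inl (0, .right) => .inr 2)
    (by decide)

/-- Three strands crossing pairwise such that the triangle between them has a coherently oriented
boundary and lies to the left of its edges.  The strand `i` enters crossing `i` on the right and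
then crossing `i + 1` on the left (indices modulo `3`). -/
def cyclicTriangleLeft (k : Fin 3 → CrossingKind) : Tangle 3 :=
  ofNext (n := 3) k
    (fun
      | .inr i => .inl (i, .right)
      | .inl (i, .left) => .inl (i + 1, .left)
      | .inl (i, .right) => .inr (i - 1))
    (by decide)

/-- The same three strands and crossings as in `cyclicTriangleLeft`, on the other side of the
triangle, which now lies to the right of its edges.  The strand `i` enters crossing `i + 1` on the
left and then crossing `i` on the right. -/
def cyclicTriangleRight (k : Fin 3 → CrossingKind) : Tangle 3 :=
  ofNext (n := 3) k
    (fun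
      | .inr i => .inl (i + 1, .left)
      | .inl (i, .right) => .inl (i - 1, .right)
      | .inl (i, .left) => .inr i)
    (by decide)

end Tangle

/-- The condition for a triangle move: at least two of the three crossings are virtual (so that one
strand has only virtual crossings), or all are classical and the three strands lie above one
another.  Here `a`, `b`, `c` are the kinds of the crossings of the strands `0` and `1`, of `1` and
`2`, and of `2` and `0`, where `pos` stands for the first strand of the pair being the upper one and
`neg` for the second one.  So the two excluded classical cases are those in which the three strands
lie above one another cyclically. -/
def CrossingKind.Triangle (a b c : CrossingKind) : Prop :=
  (a = .virt ∧ b = .virt) ∨ (b = .virt ∧ c = .virt) ∨ (a = .virt ∧ c = .virt) ∨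
    (a ≠ .virt ∧ b ≠ .virt ∧ c ≠ .virt ∧ ¬ (a = b ∧ b = c))

/-- The generalized Reidemeister moves, with all orientations: `curl` are the moves (r1) and (v1),
the bigon moves are (r2) and (v2), and the triangle moves are (r3), (v3) and (v4) according to
whether none, three or two of the crossings are virtual. -/
inductive ReidemeisterMove : {m : ℕ} → Tangle m → Tangle m → Prop
  | curl (k : CrossingKind) (a : Side) :
      ReidemeisterMove (Tangle.strands 1) (Tangle.curl k a)
  | parallelBigon (k : CrossingKind) :
      ReidemeisterMove (Tangle.strands 2) (Tangle.parallelBigon k)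
  | antiparallelBigon (k : CrossingKind) (a : Side) :
      ReidemeisterMove (Tangle.strands 2) (Tangle.antiparallelBigon k a)
  | braidTriangle (k : Fin 3 → CrossingKind)
      (h : CrossingKind.Triangle (k 0) (k 2) (k 1).opp) :
      ReidemeisterMove (Tangle.braidTriangleLeft k) (Tangle.braidTriangleRight k)
  | cyclicTriangle (k : Fin 3 → CrossingKind)
      (h : CrossingKind.Triangle (k 1) (k 2) (k 0)) :
      ReidemeisterMove (Tangle.cyclicTriangleLeft k) (Tangle.cyclicTriangleRight k)

/-- Elementary equivalences of diagrams: isomorphism, insertion of a marked point, and a generalized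
Reidemeister move inside a larger diagram. -/
inductive DiagramStep : Diagram → Diagram → Prop
  | iso {D E : Diagram} (h : D.Iso E) : DiagramStep D E
  | subdivide (D : Diagram) (p : D.Port) : DiagramStep D (D.subdivide p)
  | move {m : ℕ} {T T' : Tangle m} (h : ReidemeisterMove T T') (R : Tangle m) :
      DiagramStep (T.glue R) (T'.glue R)

/-- An oriented virtual link diagram: a diagram in the plane. -/
structure VirtualLinkDiagram extends Diagram where
  planar : toDiagram.IsPlanar

/-- An oriented virtual link: an equivalence class of virtual link diagrams, for the equivalence
relation generated by the elementary equivalences between planar diagrams. -/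
def VirtualLink : Type 1 :=
  Quot fun D E : VirtualLinkDiagram => DiagramStep D.toDiagram E.toDiagram

namespace VirtualLink

/-- `D` is a diagram of the virtual link `K`. -/
def HasDiagram (K : VirtualLink) (D : VirtualLinkDiagram) : Prop :=
  Quot.mk _ D = K

/-- `H` is the virtual Alexander polynomial of `K`, computed from some diagram of `K`. -/
def IsVirtualAlexanderPolynomial (K : VirtualLink) (H : LaurentSTQ) : Prop :=
  ∃ D : VirtualLinkDiagram, K.HasDiagram D ∧ D.IsVirtualAlexanderPolynomial H

/-- `G` is the generalized Alexander polynomial of `K`, computed from some diagram of `K`. -/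
def IsGeneralizedAlexanderPolynomial (K : VirtualLink) (G : LaurentST) : Prop :=
  ∃ D : VirtualLinkDiagram, K.HasDiagram D ∧ D.IsGeneralizedAlexanderPolynomial G

end VirtualLink

end

/-!
Both polynomials are determinants over the arcs of a diagram, and the two matrices differ by a
change of scale of the arcs.

*The virtual Alexander polynomial is the determinant of the arc block.*  The matrix of Fox
derivatives consists of the square block `A` of the arc relations and the arcs (`arcMatrix`), two
further columns for `s` and `q`, and the row `(0, 1 - q, s - 1)` of the commutator.  By the
fundamental formula of Fox calculus, `1 - q` times the column of `q` is a combination of the other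
columns, hence every maximal minor is a multiple of `det A`
(`Diagram.alexanderMatrix_mul_diagonal`, `det_dvd_prod_mul_minor`).  Deleting the columns of `s` and
of `q` gives the minors `(s - 1) det A` and `(1 - q) det A`, and since `s - 1` and `q - 1` are
coprime (`Laurent.dvd_of_dvd_X_sub_one_mul`), `det A` is the greatest common divisor.

*Planarity removes `q`.*  A plane diagram has an Alexander numbering: an integer on each arc that
is unchanged across the crossings of the underlying curve and jumps by one from the left to the
right strand.  Its existence is the vanishing of the first cohomology of the sphere.  It is
obtained from Euler's formula by a dimension count: the coboundaries of functions on the faces and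
of functions on the vertices are orthogonal, and together they span all cochains
(`Diagram.IsPlanar.exists_jump_eq`).  Multiplying each arc with the power of `q` given by the
numbering transforms `A` into the biquandle matrix at `(s q⁻¹, t q)`, so that
`det A = G(s q⁻¹, t q)` for the same diagram (`Diagram.IsPlanar.det_arcMatrix`).

*Invariance.*  It remains to see that the determinant of the biquandle matrix is, up to units,
an invariant of virtual links; this needs no planarity.  If the relation matrix of a tangle is
invertible, the tangle can be eliminated from the diagram by a Schur complement, which depends only
on the linear map from the incoming to the outgoing boundary labels
(`Tangle.associated_det_glue_of_toBlocks₂₂_eq`).  For each move, both tangles have this property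
and the same boundary map; this is verified by solving their linear systems explicitly.
-/

open scoped Matrix

noncomputable section

/-! ### Laurent polynomials: homomorphisms and coprimality -/

namespace Laurent

variable {n : ℕ} {R : Type} [CommRing R]

/-- Ring homomorphisms out of a Laurent polynomial ring are determined by the variables. -/
theorem ringHom_ext {f g : Laurent n →+* R}
    (h : ∀ i, f ((X i : (Laurent n)ˣ) : Laurent n) = g ((X i : (Laurent n)ˣ) : Laurent n)) :
    f = g := by
  refine AddMonoidAlgebra.ringHom_ext' (RingHom.ext_int _ _) ?_
  have key : ((f : Laurent n →* R).comp (AddMonoidAlgebra.of ℤ (Fin n → ℤ))).toHomUnits =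
      ((g : Laurent n →* R).comp (AddMonoidAlgebra.of ℤ (Fin n → ℤ))).toHomUnits := by
    apply MonoidHom.toAdditiveRight.injective
    refine AddMonoidHom.functions_ext' _ _ _ fun i => AddMonoidHom.ext_int ?_
    apply Additive.toMul.injective
    apply Units.ext
    exact h i
  refine MonoidHom.ext fun e => ?_
  exact congrArg Units.val (DFunLike.congr_fun key e)

theorem subst_X_inv (u : Fin n → Rˣ) (i : Fin n) :
    subst u (((X i)⁻¹ : (Laurent n)ˣ) : Laurent n) = ((u i)⁻¹ : Rˣ) := by
  have h : Units.map (subst u : Laurent n →* R) (X i) = u i := Units.ext (subst_X u i)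
  rw [← h, ← map_inv]
  rfl

/-- Setting the variable `x_i` to `1` does not change a Laurent polynomial modulo `x_i - 1`. -/
theorem X_sub_one_dvd_sub_subst (i : Fin n) (p : Laurent n) :
    ((X i : (Laurent n)ˣ) : Laurent n) - 1 ∣ p - subst (Function.update X i 1) p := by
  rw [← Ideal.mem_span_singleton, ← Ideal.Quotient.eq]
  refine DFunLike.congr_fun (f := Ideal.Quotient.mk _)
    (g := (Ideal.Quotient.mk _).comp (subst (Function.update X i 1))) (ringHom_ext fun j => ?_) p
  rw [RingHom.comp_apply, subst_X]
  obtain rfl | hj := eq_or_ne j i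
  · rw [Function.update_self, Ideal.Quotient.eq, Ideal.mem_span_singleton]
    exact dvd_rfl
  · rw [Function.update_of_ne hj]

theorem X_sub_one_dvd_iff (i : Fin n) (p : Laurent n) :
    ((X i : (Laurent n)ˣ) : Laurent n) - 1 ∣ p ↔ subst (Function.update X i 1) p = 0 := by
  constructor
  · rintro ⟨a, rfl⟩
    rw [map_mul, map_sub, subst_X, Function.update_self, map_one, Units.val_one, sub_self,
      zero_mul]
  · intro h
    simpa [h] using X_sub_one_dvd_sub_subst i p

theorem X_ne_one (i : Fin n) : ((X i : (Laurent n)ˣ) : Laurent n) ≠ 1 := by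
  intro h
  have h2 : (Pi.single i 1 : Fin n → ℤ) = 0 :=
    Multiplicative.ofAdd.injective (AddMonoidAlgebra.of_injective (R := ℤ) h)
  simpa using congrFun h2 i

theorem X_sub_one_ne_zero (i : Fin n) : ((X i : (Laurent n)ˣ) : Laurent n) - 1 ≠ 0 :=
  sub_ne_zero.mpr (X_ne_one i)

/-- By `X_sub_one_dvd_iff`, the ideal of `x_i - 1` is the kernel of a homomorphism to a domain. -/
theorem prime_X_sub_one (i : Fin n) : Prime (((X i : (Laurent n)ˣ) : Laurent n) - 1) := by
  refine ⟨X_sub_one_ne_zero i, fun h => ?_, fun a b h => ?_⟩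
  · have := (X_sub_one_dvd_iff i 1).mp h.dvd
    simp at this
  · rw [X_sub_one_dvd_iff, map_mul, mul_eq_zero] at h
    simpa only [X_sub_one_dvd_iff] using h

/-- `x_i - 1` and `x_j - 1` are coprime: a common divisor of their multiples `(x_i - 1) d` and
`(x_j - 1) d` divides `d`. -/
theorem dvd_of_dvd_X_sub_one_mul {i j : Fin n} (hij : i ≠ j) {g d : Laurent n}
    (hi : g ∣ (((X i : (Laurent n)ˣ) : Laurent n) - 1) * d)
    (hj : g ∣ (((X j : (Laurent n)ˣ) : Laurent n) - 1) * d) : g ∣ d := by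
  obtain rfl | hd0 := eq_or_ne d 0
  · exact dvd_zero g
  have hp := prime_X_sub_one i
  obtain ⟨h, hh⟩ := hi
  suffices hd : ((X i : (Laurent n)ˣ) : Laurent n) - 1 ∣ h by
    obtain ⟨k, rfl⟩ := hd
    exact ⟨k, mul_left_cancel₀ hp.ne_zero (by rw [hh]; ring)⟩
  obtain ⟨g', rfl⟩ | hd := hp.dvd_or_dvd (Dvd.intro d hh)
  · have hd : d = g' * h := mul_left_cancel₀ hp.ne_zero (by rw [hh]; ring)
    have hg : g' ≠ 0 := by
      rintro rfl
      exact hd0 (by rw [hd, zero_mul])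
    rw [hd, mul_left_comm, mul_comm _ g', mul_dvd_mul_iff_left hg] at hj
    refine (hp.dvd_or_dvd hj).resolve_left fun hc => X_sub_one_ne_zero j ?_
    rw [X_sub_one_dvd_iff, map_sub, subst_X, Function.update_of_ne hij.symm, map_one] at hc
    exact hc
  · exact hd

end Laurent

/-! ### Fox calculus -/

namespace Fox

variable {γ : Type} [DecidableEq γ] {R : Type} [CommRing R]

/-- The Fox derivative `∂w/∂x_j`, evaluated in a commutative ring along `x_g ↦ a g`. -/
def evalDeriv (a : γ → Rˣ) (j : γ) (w : FreeGroup γ) : R :=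
  MonoidAlgebra.lift ℤ R (FreeGroup γ) ((Units.coeHom R).comp (FreeGroup.lift a)) (deriv j w)

theorem alexanderMatrix_apply {ρ : Type} (a : γ → Rˣ) (r : ρ → FreeGroup γ) (i : ρ) (g : γ) :
    alexanderMatrix a r i g = evalDeriv a g (r i) := rfl

theorem evalDeriv_of (a : γ → Rˣ) (j i : γ) :
    evalDeriv a j (FreeGroup.of i) = if i = j then 1 else 0 := by
  rw [evalDeriv, deriv_of]
  split_ifs <;> simp

theorem evalDeriv_mul (a : γ → Rˣ) (j : γ) (u v : FreeGroup γ) :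
    evalDeriv a j (u * v) = evalDeriv a j u + (FreeGroup.lift a u : Rˣ) * evalDeriv a j v := by
  simp [evalDeriv, deriv_mul]

theorem evalDeriv_one (a : γ → Rˣ) (j : γ) : evalDeriv a j 1 = 0 := by
  simpa using evalDeriv_mul a j 1 1

theorem evalDeriv_inv (a : γ → Rˣ) (j : γ) (w : FreeGroup γ) :
    evalDeriv a j w⁻¹ = -(((FreeGroup.lift a w)⁻¹ : Rˣ) * evalDeriv a j w) := by
  have h := evalDeriv_mul a j w⁻¹ w
  rw [inv_mul_cancel, evalDeriv_one, map_inv] at h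
  exact eq_neg_of_add_eq_zero_left h.symm

/-- The fundamental formula of Fox calculus, `∑_g (∂w/∂x_g) (x_g - 1) = w - 1`. -/
theorem sum_evalDeriv_mul [Fintype γ] (a : γ → Rˣ) (w : FreeGroup γ) :
    ∑ g, evalDeriv a g w * ((a g : R) - 1) = (FreeGroup.lift a w : Rˣ) - 1 := by
  induction w using FreeGroup.induction_on with
  | C1 => simp [evalDeriv_one]
  | of i => simp [evalDeriv_of]
  | inv_of i h =>
    simp only [evalDeriv_inv, neg_mul, mul_assoc, Finset.sum_neg_distrib, ← Finset.mul_sum, h]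
    simp [mul_sub]
  | mul u v hu hv =>
    simp only [evalDeriv_mul, add_mul, mul_assoc, Finset.sum_add_distrib, ← Finset.mul_sum, hu, hv]
    simp
    ring

end Fox

/-! ### Minors of a matrix that factors through a square one -/

/-- The minors of size `card ι` of a matrix `M` with rows `ι` satisfy
`(∏ d) * minor ∈ (det B)` as soon as the matrix obtained from `M` by scaling the column `g` with
`d g` is a left multiple of the square matrix `B`. -/
theorem det_dvd_prod_mul_minor {ι γ R : Type} [Fintype ι] [DecidableEq ι] [Fintype γ]
    [DecidableEq γ] [CommRing R] {k : ℕ} (hk : k = Fintype.card ι) (M C : Matrix ι γ R)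
    (B : Matrix ι ι R) (d : γ → R) (h : M * Matrix.diagonal d = B * C)
    (c₁ : Fin k → ι) (c₂ : Fin k → γ) :
    B.det ∣ (∏ g, d g) * (M.submatrix c₁ c₂).det := by
  by_cases h₁ : Function.Injective c₁
  swap
  · obtain ⟨x, y, hxy, hne⟩ := Function.not_injective_iff.mp h₁
    rw [Matrix.det_zero_of_row_eq hne (by ext; simp [hxy]), mul_zero]
    exact dvd_zero _
  by_cases h₂ : Function.Injective c₂
  swap
  · obtain ⟨x, y, hxy, hne⟩ := Function.not_injective_iff.mp h₂
    rw [Matrix.det_zero_of_column_eq hne (by simp [hxy]), mul_zero]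
    exact dvd_zero _
  let e : Fin k ≃ ι := Equiv.ofBijective c₁
    ((Fintype.bijective_iff_injective_and_card _).mpr ⟨h₁, by simp [hk]⟩)
  have hd : ∏ x, d (c₂ x) ∣ ∏ g, d g := by
    rw [← Finset.prod_image (g := c₂) (f := d) (fun x _ y _ hxy => h₂ hxy)]
    exact Finset.prod_dvd_prod_of_subset _ _ _ (Finset.subset_univ _)
  have hM : (∏ x, d (c₂ x)) * (M.submatrix c₁ c₂).det =
      B.det * (C.submatrix e c₂).det := by
    rw [← Matrix.det_submatrix_equiv_self e B, ← Matrix.det_mul, Matrix.submatrix_mul_equiv, ← h,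
      ← Matrix.det_mul_row]
    congr 1
    ext x y
    simp [e, mul_comm]
  exact (Dvd.intro _ hM.symm).trans (mul_dvd_mul_right hd _)

/-- Minors whose rows and columns are indexed by an arbitrary finite type belong to the ideal of
minors. -/
theorem minor_mem_minorIdeal {ρ γ ι R : Type} [CommRing R] [Fintype ι] [DecidableEq ι]
    (M : Matrix ρ γ R) {k : ℕ} (hk : k = Fintype.card ι) (c₁ : ι → ρ) (c₂ : ι → γ) :
    (M.submatrix c₁ c₂).det ∈ minorIdeal M k := by
  let e : Fin k ≃ ι := (finCongr hk).trans (Fintype.equivFin ι).symm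
  refine Ideal.subset_span ⟨(c₁ ∘ e, c₂ ∘ e), ?_⟩
  exact Matrix.det_submatrix_equiv_self e (M.submatrix c₁ c₂)

/-! ### The virtual Alexander polynomial as the determinant of the arc block -/

namespace Diagram

variable (D : Diagram)

open Fox

instance : Fintype D.Gen :=
  Fintype.ofEquiv (D.Port ⊕ (Unit ⊕ Unit))
    { toFun := Sum.elim Gen.arc (Sum.elim (fun _ => Gen.s) (fun _ => Gen.q))
      invFun := fun
        | .arc p => .inl p
        | .s => .inr (.inl ())
        | .q => .inr (.inr ())
      left_inv := by rintro (_ | _ | _) <;> rfl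
      right_inv := by rintro (_ | _ | _) <;> rfl }

theorem univ_gen : (Finset.univ : Finset D.Gen) =
    insert Gen.s (insert Gen.q (Finset.univ.image Gen.arc)) := by
  ext (p | _ | _) <;> simp

@[to_additive]
theorem prod_gen {M : Type} [CommMonoid M] (f : D.Gen → M) :
    ∏ g, f g = f .s * (f .q * ∏ p, f (.arc p)) := by
  rw [univ_gen, Finset.prod_insert (by simp), Finset.prod_insert (by simp), Finset.prod_image]
  exact fun _ _ _ _ h => Gen.arc.inj h

theorem lift_abel_label (p : D.Port) : FreeGroup.lift D.abel (D.label p) = LaurentSTQ.t := by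
  obtain ⟨c, a⟩ | x := p
  · cases h : D.kind c <;> cases a <;> simp [label, h, abel, mul_comm, mul_assoc]
  · simp [label, abel]

theorem evalDeriv_relator_inl (g : D.Gen) (p : D.Port) :
    evalDeriv D.abel g (D.relator (.inl p)) =
      evalDeriv D.abel g (FreeGroup.of (.arc (D.next p))) - evalDeriv D.abel g (D.label p) := by
  rw [relator, evalDeriv_mul, evalDeriv_inv, lift_abel_label, FreeGroup.lift_apply_of, abel]
  simp [sub_eq_add_neg]

/-- The block of the Alexander matrix formed by the rows of the arc relations and the columns of
the arcs. -/
def arcMatrix : Matrix D.Port D.Port LaurentSTQ :=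
  Matrix.of fun p a => evalDeriv D.abel (.arc a) (D.relator (.inl p))

theorem evalDeriv_relator_inr (u : Unit) (g : D.Gen) :
    evalDeriv D.abel g (D.relator (.inr u)) =
      match g with
      | .arc _ => 0
      | .s => 1 - (LaurentSTQ.q : LaurentSTQ)
      | .q => (LaurentSTQ.s : LaurentSTQ) - 1 := by
  have h : (LaurentSTQ.s : LaurentSTQ) * LaurentSTQ.q * (LaurentSTQ.s⁻¹ : LaurentSTQˣ) =
      LaurentSTQ.q := by
    rw [mul_right_comm, Units.mul_inv, one_mul]
  cases g <;> simp [relator, evalDeriv_mul, evalDeriv_inv, evalDeriv_of, abel, h] <;> ring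

/-- The fundamental formula of Fox calculus for the arc relation at `p`. -/
theorem sum_evalDeriv_relator_inl (p : D.Port) :
    (∑ a, D.arcMatrix p a) * ((LaurentSTQ.t : LaurentSTQ) - 1) +
      evalDeriv D.abel .s (D.relator (.inl p)) * ((LaurentSTQ.s : LaurentSTQ) - 1) =
      evalDeriv D.abel .q (D.relator (.inl p)) * (1 - (LaurentSTQ.q : LaurentSTQ)) := by
  have h := sum_evalDeriv_mul D.abel (D.relator (.inl p))
  rw [sum_gen] at h
  simp only [relator, map_mul, map_inv, lift_abel_label, FreeGroup.lift_apply_of] at h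
  simp only [abel, mul_inv_cancel, Units.val_one, sub_self] at h
  rw [Finset.sum_mul]
  simp only [relator, arcMatrix, Matrix.of_apply]
  linear_combination h

/-- The square part of the Alexander matrix that is left when the column of `q` is deleted. -/
def deleteQ : Matrix (D.Port ⊕ Unit) (D.Port ⊕ Unit) LaurentSTQ :=
  Matrix.fromBlocks D.arcMatrix (Matrix.of fun p _ => evalDeriv D.abel .s (D.relator (.inl p)))
    0 (Matrix.of fun _ _ => 1 - (LaurentSTQ.q : LaurentSTQ))

theorem det_deleteQ : D.deleteQ.det = D.arcMatrix.det * (1 - (LaurentSTQ.q : LaurentSTQ)) := by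
  simp [deleteQ]

/-- The square part of the Alexander matrix that is left when the column of `s` is deleted. -/
def deleteS : Matrix (D.Port ⊕ Unit) (D.Port ⊕ Unit) LaurentSTQ :=
  Matrix.fromBlocks D.arcMatrix (Matrix.of fun p _ => evalDeriv D.abel .q (D.relator (.inl p)))
    0 (Matrix.of fun _ _ => (LaurentSTQ.s : LaurentSTQ) - 1)

theorem det_deleteS : D.deleteS.det = D.arcMatrix.det * ((LaurentSTQ.s : LaurentSTQ) - 1) := by
  simp [deleteS]

/-- By the fundamental formula of Fox calculus, the column of `q`, multiplied by `1 - q`, is a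
combination of the other columns. -/
theorem alexanderMatrix_mul_diagonal :
    alexanderMatrix D.abel D.relator * Matrix.diagonal
        (fun (g : D.Gen) => match g with
          | .q => 1 - (LaurentSTQ.q : LaurentSTQ)
          | _ => 1) =
      D.deleteQ * (Matrix.of fun i (g : D.Gen) => match i, g with
        | .inl p, .arc a => if p = a then 1 else 0
        | .inl _, .s => 0
        | .inl _, .q => (LaurentSTQ.t : LaurentSTQ) - 1
        | .inr _, .arc _ => 0
        | .inr _, .s => 1
        | .inr _, .q => (LaurentSTQ.s : LaurentSTQ) - 1 :
        Matrix (D.Port ⊕ Unit) D.Gen LaurentSTQ) := by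
  ext i g : 1
  rw [Matrix.mul_diagonal, alexanderMatrix_apply, Matrix.mul_apply, Fintype.sum_sum_type]
  obtain p | u := i
  · cases g with
    | arc a => simp [deleteQ, arcMatrix]
    | s => simp [deleteQ]
    | q =>
      simp only [deleteQ, Matrix.fromBlocks_apply₁₁, Matrix.of_apply, Matrix.fromBlocks_apply₁₂,
        ← Finset.sum_mul, Finset.univ_unique, Finset.sum_singleton]
      exact (D.sum_evalDeriv_relator_inl p).symm
  · cases g <;> simp [deleteQ, evalDeriv_relator_inr, mul_comm]

/-- The determinant of the arc block is the greatest common divisor of the minors: all minors are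
multiples of it, and those obtained by deleting the columns of `s` and of `q` are its multiples with
the coprime elements `1 - q` and `s - 1`. -/
theorem isVirtualAlexanderPolynomial_det_arcMatrix :
    D.IsVirtualAlexanderPolynomial D.arcMatrix.det := by
  have hcard : Fintype.card D.Port + 1 = Fintype.card (D.Port ⊕ Unit) := by simp
  have hq : (1 : LaurentSTQ) - (LaurentSTQ.q : LaurentSTQ) ≠ 0 :=
    sub_ne_zero.mpr (Laurent.X_ne_one 2).symm
  refine ⟨⟨⟨⟨_, rfl⟩⟩, ?_⟩, ?_⟩
  · rw [elementaryIdeal, minorIdeal, Ideal.span_le]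
    rintro _ ⟨⟨c₁, c₂⟩, rfl⟩
    have h := det_dvd_prod_mul_minor hcard _ _ _ _ D.alexanderMatrix_mul_diagonal c₁ c₂
    rw [det_deleteQ, prod_gen] at h
    simp only [Finset.prod_const_one, mul_one, one_mul] at h
    rw [mul_comm, mul_dvd_mul_iff_left hq] at h
    exact Ideal.mem_span_singleton.mpr h
  · rintro J ⟨⟨g, rfl⟩, hJ⟩
    have hs : D.deleteS.det ∈ Ideal.span {g} := by
      have h : D.deleteS = (alexanderMatrix D.abel D.relator).submatrix id
          (Sum.elim Gen.arc fun _ => Gen.q) := by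
        ext (p | u) (a | v) : 1 <;>
          simp [deleteS, alexanderMatrix_apply, arcMatrix, evalDeriv_relator_inr]
      exact hJ (h ▸ minor_mem_minorIdeal _ hcard _ _)
    have hq : D.deleteQ.det ∈ Ideal.span {g} := by
      have h : D.deleteQ = (alexanderMatrix D.abel D.relator).submatrix id
          (Sum.elim Gen.arc fun _ => Gen.s) := by
        ext (p | u) (a | v) : 1 <;>
          simp [deleteQ, alexanderMatrix_apply, arcMatrix, evalDeriv_relator_inr]
      exact hJ (h ▸ minor_mem_minorIdeal _ hcard _ _)
    rw [det_deleteS, Ideal.mem_span_singleton, mul_comm] at hs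
    rw [det_deleteQ, Ideal.mem_span_singleton, mul_comm, ← neg_sub, neg_mul, dvd_neg] at hq
    exact (Ideal.span_singleton_le_span_singleton).mpr
      (Laurent.dvd_of_dvd_X_sub_one_mul (i := 0) (j := 2) (by decide) hs hq)

end Diagram

/-- A greatest common divisor is unique up to units. -/
theorem GeneratesPrincipalHull.associated {R : Type} [CommRing R] [IsDomain R] {I : Ideal R}
    {f g : R} (hf : GeneratesPrincipalHull I f) (hg : GeneratesPrincipalHull I g) :
    Associated f g :=
  Ideal.span_singleton_eq_span_singleton.mp (IsLeast.unique hf hg)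

/-! ### Alexander numberings of planar diagrams -/

/-- The rational functions that are invariant under a permutation group. -/
def Equiv.Perm.invariantFunctions {X : Type} (G : Subgroup (Equiv.Perm X)) :
    Submodule ℚ (X → ℚ) where
  carrier := {w | ∀ g ∈ G, ∀ x, w (g x) = w x}
  add_mem' hv hw g hg x := by simp [hv g hg x, hw g hg x]
  zero_mem' _ _ _ := rfl
  smul_mem' a w hw g hg x := by simp [hw g hg x]

open Equiv.Perm (invariantFunctions)

theorem Equiv.Perm.finrank_invariantFunctions {X : Type} [Finite X]
    (G : Subgroup (Equiv.Perm X)) :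
    Module.finrank ℚ (invariantFunctions G) = Nat.card (MulAction.orbitRel.Quotient G X) := by
  classical
  have := Fintype.ofFinite (MulAction.orbitRel.Quotient G X)
  rw [Nat.card_eq_fintype_card, ← Module.finrank_fintype_fun_eq_card ℚ]
  have hlift (w : invariantFunctions G) (x y : X) (h : (MulAction.orbitRel G X) x y) :
      w.1 x = w.1 y := by
    obtain ⟨⟨g, hg⟩, rfl⟩ := h
    exact w.2 g hg y
  exact LinearEquiv.finrank_eq
    { toFun := fun w => Quotient.lift w.1 (hlift w)
      invFun := fun f => ⟨fun x => f (Quotient.mk _ x), fun g hg x =>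
        congrArg f (Quotient.sound ⟨⟨g, hg⟩, rfl⟩)⟩
      map_add' := fun v w => by ext ⟨x⟩; rfl
      map_smul' := fun a w => by ext ⟨x⟩; rfl
      left_inv := fun w => rfl
      right_inv := fun f => by ext ⟨x⟩; rfl }

theorem Equiv.Perm.mem_invariantFunctions_closure {X : Type} {S : Set (Equiv.Perm X)}
    {w : X → ℚ} :
    w ∈ invariantFunctions (Subgroup.closure S) ↔ ∀ g ∈ S, ∀ x, w (g x) = w x := by
  refine ⟨fun h g hg => h g (Subgroup.subset_closure hg), fun h k hk => ?_⟩
  induction hk using Subgroup.closure_induction with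
  | mem g hg => exact h g hg
  | one => simp
  | mul a b _ _ ha hb => intro x; rw [Equiv.Perm.mul_apply, ha, hb]
  | inv a _ ha => intro x; rw [← ha, ← Equiv.Perm.mul_apply, mul_inv_cancel, Equiv.Perm.one_apply]

theorem Equiv.Perm.mem_invariantFunctions_zpowers {X : Type} {g : Equiv.Perm X} {w : X → ℚ} :
    w ∈ invariantFunctions (Subgroup.zpowers g) ↔ ∀ x, w (g x) = w x := by
  rw [Subgroup.zpowers_eq_closure, mem_invariantFunctions_closure]
  simp

/-- Rank-nullity for the restriction of `f` to `S`, as an inequality. -/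
theorem Submodule.finrank_le_finrank_map_add {K V W : Type} [Field K] [AddCommGroup V] [Module K V]
    [FiniteDimensional K V] [AddCommGroup W] [Module K W] (f : V →ₗ[K] W) (S N : Submodule K V)
    (h : S ⊓ LinearMap.ker f ≤ N) :
    Module.finrank K S ≤ Module.finrank K (S.map f) + Module.finrank K N := by
  rw [← LinearMap.finrank_range_add_finrank_ker (f.domRestrict S), LinearMap.range_domRestrict]
  refine Nat.add_le_add_left ?_ _
  refine LinearMap.finrank_le_finrank_of_injective
    (f := (S.subtype.comp (LinearMap.ker (f.domRestrict S)).subtype).codRestrict N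
      fun x => h ⟨x.1.2, x.2⟩) fun x y hxy => ?_
  exact Subtype.ext (Subtype.ext (congrArg (fun z : N => (z : V)) hxy))

namespace Diagram

variable (D : Diagram)

/-- The linear map `w ↦ w - w ∘ flip`: on functions on the faces it measures the difference of the
values on the two sides of an arc, on functions on the vertices that of the values at its ends. -/
def jump : (D.HalfEdge → ℚ) →ₗ[ℚ] (D.HalfEdge → ℚ) :=
  LinearMap.id - LinearMap.funLeft ℚ ℚ D.flip

theorem jump_apply (w : D.HalfEdge → ℚ) (x : D.HalfEdge) :
    D.jump w x = w x - w (D.flip x) := rfl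

theorem flip_flip (x : D.HalfEdge) : D.flip (D.flip x) = x := by
  obtain p | p := x <;> simp [flip]

/-- The vertex at which a half-edge is attached. -/
def vertex : D.HalfEdge → D.Crossing ⊕ D.Point :=
  Sum.elim (Sum.map Prod.fst id) (Sum.map Prod.fst id)

theorem vertex_rotation (x : D.HalfEdge) : D.vertex (D.rotation x) = D.vertex x := by
  obtain (⟨c, _ | _⟩ | x) | (⟨c, _ | _⟩ | x) := x <;> rfl

theorem vertex_surjective : Function.Surjective D.vertex := by
  rintro (c | x)
  · exact ⟨.inl (.inl (c, .left)), rfl⟩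
  · exact ⟨.inl (.inr x), rfl⟩

/-- The functions on the half-edges that only depend on the vertex. -/
def vertexFunctions : Submodule ℚ (D.HalfEdge → ℚ) :=
  LinearMap.range (LinearMap.funLeft ℚ ℚ D.vertex)

theorem finrank_vertexFunctions :
    Module.finrank ℚ D.vertexFunctions = Fintype.card D.Crossing + Fintype.card D.Point := by
  rw [vertexFunctions, LinearMap.finrank_range_of_inj
    (LinearMap.funLeft_injective_of_surjective _ _ _ D.vertex_surjective),
    Module.finrank_fintype_fun_eq_card, Fintype.card_sum]

/-- The functions on the half-edges that are constant on the faces. -/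
def faceFunctions : Submodule ℚ (D.HalfEdge → ℚ) :=
  invariantFunctions (Subgroup.zpowers (D.rotation * D.flip))

/-- The cochains on the arcs: the functions on the half-edges that change sign when the ends of an
arc are exchanged. -/
def arcCochains : Submodule ℚ (D.HalfEdge → ℚ) :=
  LinearMap.ker (LinearMap.id + LinearMap.funLeft ℚ ℚ D.flip)

theorem mem_arcCochains {w : D.HalfEdge → ℚ} :
    w ∈ D.arcCochains ↔ ∀ x, w x + w (D.flip x) = 0 :=
  funext_iff

theorem finrank_arcCochains_le : Module.finrank ℚ D.arcCochains ≤ Fintype.card D.Port := by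
  rw [← Module.finrank_fintype_fun_eq_card ℚ]
  refine LinearMap.finrank_le_finrank_of_injective
    (f := (LinearMap.funLeft ℚ ℚ Sum.inr).comp D.arcCochains.subtype) ?_
  rw [← LinearMap.ker_eq_bot, LinearMap.ker_eq_bot']
  rintro ⟨w, hw⟩ h
  have h0 (p : D.Port) : w (.inr p) = 0 := congrFun h p
  refine Subtype.ext (funext fun x => ?_)
  obtain a | p := x
  · have h1 := D.mem_arcCochains.mp hw (.inl a)
    rw [show D.flip (.inl a) = .inr (D.next.symm a) from rfl, h0, add_zero] at h1
    exact h1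
  · exact h0 p

theorem map_jump_le (S : Submodule ℚ (D.HalfEdge → ℚ)) : S.map D.jump ≤ D.arcCochains := by
  rintro _ ⟨w, -, rfl⟩
  rw [mem_arcCochains]
  intro x
  rw [jump_apply, jump_apply, flip_flip]
  ring

/-- A function in the kernel of `jump` is invariant under `flip`; if this forces invariance under
`rotation`, the kernel is the space of functions on the connected components. -/
theorem le_finrank_map_jump {S : Submodule ℚ (D.HalfEdge → ℚ)}
    (hS : ∀ w ∈ S, (∀ x, w (D.flip x) = w x) → ∀ x, w (D.rotation x) = w x) :
    Module.finrank ℚ S ≤ Module.finrank ℚ (S.map D.jump) + D.numComponents := by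
  rw [numComponents, ← Equiv.Perm.finrank_invariantFunctions]
  refine Submodule.finrank_le_finrank_map_add _ _ _ ?_
  rintro w ⟨hw, hk⟩
  have hf (x : D.HalfEdge) : w (D.flip x) = w x := (sub_eq_zero.mp (congrFun hk x)).symm
  rw [Equiv.Perm.mem_invariantFunctions_closure]
  rintro g (rfl | rfl)
  · exact hS w hw hf
  · exact hf

/-- The coboundaries of functions on the faces and of functions on the vertices are orthogonal. -/
theorem jump_dotProduct_jump {w f : D.HalfEdge → ℚ} (hw : w ∈ D.faceFunctions)
    (hf : f ∈ D.vertexFunctions) : D.jump w ⬝ᵥ D.jump f = 0 := by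
  obtain ⟨f, rfl⟩ := hf
  set v := LinearMap.funLeft ℚ ℚ D.vertex f
  have hv (x : D.HalfEdge) : v (D.rotation x) = v x := congrArg f (D.vertex_rotation x)
  have hw (x : D.HalfEdge) : w (D.rotation (D.flip x)) = w x :=
    Equiv.Perm.mem_invariantFunctions_zpowers.mp hw x
  have h1 : ∑ x, w (D.flip x) * v (D.flip x) = ∑ x, w x * v x :=
    Equiv.sum_comp D.flip fun x => w x * v x
  have h2 : ∑ x, w x * v (D.flip x) = ∑ x, w x * v x := by
    rw [← Equiv.sum_comp (D.flip.trans D.rotation) fun x => w x * v x]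
    simp only [Equiv.trans_apply, hv, hw]
  have h3 : ∑ x, w (D.flip x) * v x = ∑ x, w x * v (D.flip x) := by
    rw [← Equiv.sum_comp D.flip fun x => w x * v (D.flip x)]
    simp only [flip_flip]
  simp only [dotProduct, jump_apply, sub_mul, mul_sub, Finset.sum_sub_distrib, h1, h2, h3]
  ring

/-- The cochain that is `1` on outgoing and `-1` on incoming half-edges. -/
def orientationCochain : D.HalfEdge → ℚ := Sum.elim (fun _ => -1) (fun _ => 1)

theorem orientationCochain_flip (x : D.HalfEdge) :
    D.orientationCochain (D.flip x) = -D.orientationCochain x := by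
  obtain p | p := x <;> simp [flip, orientationCochain]

theorem orientationCochain_mem : D.orientationCochain ∈ D.arcCochains := by
  rw [mem_arcCochains]
  intro x
  rw [orientationCochain_flip, add_neg_cancel]

/-- Every vertex has as many outgoing as incoming half-edges. -/
theorem orientationCochain_dotProduct_jump {f : D.HalfEdge → ℚ} (hf : f ∈ D.vertexFunctions) :
    D.orientationCochain ⬝ᵥ D.jump f = 0 := by
  obtain ⟨f, rfl⟩ := hf
  set v := LinearMap.funLeft ℚ ℚ D.vertex f
  have h0 : ∑ x, D.orientationCochain x * v x = 0 := by
    rw [Fintype.sum_sum_type]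
    have h (p : D.Port) : v (.inl p) = v (.inr p) := rfl
    simp [orientationCochain, h]
  have h1 : ∑ x, D.orientationCochain x * v (D.flip x) = 0 := by
    rw [← Equiv.sum_comp D.flip]
    simp only [flip_flip, orientationCochain_flip, neg_mul, Finset.sum_neg_distrib, h0, neg_zero]
  simp only [dotProduct, jump_apply, mul_sub, Finset.sum_sub_distrib, h0, h1, sub_zero]

/-- The cohomological form of planarity: the orientation cochain is the coboundary of a function on
the faces.  By Euler's formula the spaces of coboundaries of functions on the faces and on the
vertices together have the dimension of the space of all cochains, so they are orthogonal
complements of each other. -/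
theorem IsPlanar.exists_jump_eq {D : Diagram} (h : D.IsPlanar) :
    ∃ w ∈ D.faceFunctions, D.jump w = D.orientationCochain := by
  set F := D.faceFunctions.map D.jump
  set V := D.vertexFunctions.map D.jump
  have hFV : ∀ a ∈ F, ∀ b ∈ V, a ⬝ᵥ b = 0 := by
    rintro _ ⟨w, hw, rfl⟩ _ ⟨f, hf, rfl⟩
    exact D.jump_dotProduct_jump hw hf
  have hdisj : F ⊓ V = ⊥ := by
    rw [eq_bot_iff]
    rintro a ⟨ha, hb⟩
    exact dotProduct_self_eq_zero.mp (hFV a ha a hb)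
  have hF : D.numFaces ≤ Module.finrank ℚ F + D.numComponents := by
    rw [numFaces, ← Equiv.Perm.finrank_invariantFunctions]
    refine D.le_finrank_map_jump fun w hw hf x => ?_
    have h1 := Equiv.Perm.mem_invariantFunctions_zpowers.mp hw (D.flip x)
    rwa [Equiv.Perm.mul_apply, flip_flip, hf] at h1
  have hV : Fintype.card D.Crossing + Fintype.card D.Point ≤
      Module.finrank ℚ V + D.numComponents := by
    rw [← finrank_vertexFunctions]
    refine D.le_finrank_map_jump ?_
    rintro _ ⟨f, rfl⟩ - x
    exact congrArg f (D.vertex_rotation x)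
  have hsum := Submodule.finrank_sup_add_finrank_inf_eq F V
  rw [hdisj, finrank_bot] at hsum
  have htop : F ⊔ V = D.arcCochains := by
    refine Submodule.eq_of_le_of_finrank_le (sup_le (D.map_jump_le _) (D.map_jump_le _)) ?_
    have := D.finrank_arcCochains_le
    rw [IsPlanar] at h
    omega
  have hmem := D.orientationCochain_mem
  rw [← htop, Submodule.mem_sup] at hmem
  obtain ⟨a, ha, b, hb, hab⟩ := hmem
  have hbb : b ⬝ᵥ b = 0 := by
    obtain ⟨f, hf, rfl⟩ := id hb
    have h1 := D.orientationCochain_dotProduct_jump hf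
    rwa [← hab, add_dotProduct, hFV a ha _ hb, zero_add] at h1
  rw [dotProduct_self_eq_zero.mp hbb, add_zero] at hab
  obtain ⟨w, hw, rfl⟩ := ha
  exact ⟨w, hw, hab⟩

/-- An Alexander numbering: an integer on each arc, the index of the region on one side of it.  With
all arcs directed upwards, the index is unchanged along the left and along the right side of a
crossing, and the right one exceeds the left one by one. -/
structure IsAlexanderNumbering (h : D.Port → ℤ) : Prop where
  next_left : ∀ c, h (D.next (.inl (c, .left))) = h (.inl (c, .left))
  next_right : ∀ c, h (D.next (.inl (c, .right))) = h (.inl (c, .right))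
  right : ∀ c, h (.inl (c, .right)) = h (.inl (c, .left)) + 1
  next_point : ∀ x, h (D.next (.inr x)) = h (.inr x)

/-- The face function obtained from planarity is only rational, but its values on the faces around
a vertex differ by integers, so that rounding down gives an Alexander numbering. -/
theorem IsPlanar.exists_isAlexanderNumbering {D : Diagram} (hD : D.IsPlanar) :
    ∃ h : D.Port → ℤ, D.IsAlexanderNumbering h := by
  obtain ⟨w, hw, hj⟩ := hD.exists_jump_eq
  have hrot (x : D.HalfEdge) : w (D.rotation (D.flip x)) = w x :=
    Equiv.Perm.mem_invariantFunctions_zpowers.mp hw x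
  set h : D.Port → ℚ := fun a => w (.inr (D.next.symm a)) with hh
  have hin (a : D.Port) : w (.inl a) = h a - 1 := by
    have h1 := congrFun hj (.inr (D.next.symm a))
    simp only [jump_apply, flip, Equiv.coe_fn_mk, Equiv.apply_symm_apply, orientationCochain,
      Sum.elim_inr] at h1
    rw [hh]
    linarith
  have hout (p : D.Port) : w (.inr p) = h (D.next p) := by simp [hh]
  have hl (c : D.Crossing) : h (.inl (c, .right)) = h (.inl (c, .left)) + 1 := by
    have h1 := hrot (D.flip (.inl (.inl (c, .left))))
    rw [flip_flip] at h1
    have h2 : w (D.flip (.inl (.inl (c, .left)))) = h (.inl (c, .left)) := rfl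
    have h3 : D.rotation (.inl (.inl (c, .left))) = .inl (.inl (c, .right)) := rfl
    rw [h2, h3, hin] at h1
    linarith
  have hr (c : D.Crossing) : h (D.next (.inl (c, .right))) = h (.inl (c, .right)) := by
    have h1 := hrot (D.flip (.inl (.inl (c, .right))))
    rw [flip_flip] at h1
    have h2 : w (D.flip (.inl (.inl (c, .right)))) = h (.inl (c, .right)) := rfl
    have h3 : D.rotation (.inl (.inl (c, .right))) = .inr (.inl (c, .right)) := rfl
    rwa [h2, h3, hout] at h1
  have hL (c : D.Crossing) : h (D.next (.inl (c, .left))) = h (.inl (c, .left)) := by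
    have h1 := hrot (D.flip (.inr (.inl (c, .left))))
    rw [flip_flip] at h1
    have h2 : w (D.flip (.inr (.inl (c, .left)))) = h (D.next (.inl (c, .left))) - 1 := hin _
    have h3 : D.rotation (.inr (.inl (c, .left))) = .inl (.inl (c, .left)) := rfl
    rw [h2, h3, hin] at h1
    linarith
  have hx (x : D.Point) : h (D.next (.inr x)) = h (.inr x) := by
    have h1 := hrot (D.flip (.inl (.inr x)))
    rw [flip_flip] at h1
    have h2 : w (D.flip (.inl (.inr x))) = h (.inr x) := rfl
    have h3 : D.rotation (.inl (.inr x)) = .inr (.inr x) := rfl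
    rwa [h2, h3, hout] at h1
  exact ⟨fun a => ⌊h a⌋, fun c => by rw [hL], fun c => by rw [hr],
    fun c => by rw [hl, Int.floor_add_one], fun x => by rw [hx]⟩

end Diagram

/-! ### Comparison of the two determinants -/

namespace Diagram

variable {D : Diagram}

/-- The substitution `G(s, t) ↦ G(s q⁻¹, t q)`. -/
abbrev toSTQ : LaurentST →+* LaurentSTQ :=
  Laurent.subst ![LaurentSTQ.s * LaurentSTQ.q⁻¹, LaurentSTQ.t * LaurentSTQ.q]

theorem toSTQ_s : toSTQ (LaurentST.s : LaurentST) =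
    (LaurentSTQ.s : LaurentSTQ) * (LaurentSTQ.q⁻¹ : LaurentSTQˣ) :=
  (Laurent.subst_X _ 0).trans (by simp)

theorem toSTQ_t : toSTQ (LaurentST.t : LaurentST) =
    (LaurentSTQ.t : LaurentSTQ) * (LaurentSTQ.q : LaurentSTQ) :=
  (Laurent.subst_X _ 1).trans (by simp)

theorem toSTQ_s_inv : toSTQ (LaurentST.s⁻¹ : LaurentSTˣ) =
    (LaurentSTQ.s⁻¹ : LaurentSTQˣ) * (LaurentSTQ.q : LaurentSTQ) :=
  (Laurent.subst_X_inv _ 0).trans (by simp [mul_comm])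

theorem toSTQ_t_inv : toSTQ (LaurentST.t⁻¹ : LaurentSTˣ) =
    (LaurentSTQ.t⁻¹ : LaurentSTQˣ) * (LaurentSTQ.q⁻¹ : LaurentSTQˣ) :=
  (Laurent.subst_X_inv _ 1).trans (by simp [mul_comm])

/-- Rescaling the arcs with powers of `q` given by an Alexander numbering turns the abelianized
relations of the virtual knot group into those of the Alexander biquandle: the powers of `q`
at virtual crossings are removed, and `s` and `t` are replaced at classical ones. -/
theorem IsAlexanderNumbering.evalDeriv_label {h : D.Port → ℤ} (hh : D.IsAlexanderNumbering h)
    (p a : D.Port) :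
    Fox.evalDeriv D.abel (.arc a) (D.label p) =
      (LaurentSTQ.q ^ h (D.next p) : LaurentSTQˣ) *
        ((LaurentSTQ.q ^ (-h a) : LaurentSTQˣ) * toSTQ (D.biquandleRule p a)) := by
  have hs : (LaurentSTQ.s : LaurentSTQ) * (LaurentSTQ.s⁻¹ : LaurentSTQˣ) = 1 := Units.mul_inv _
  have ht : (LaurentSTQ.t : LaurentSTQ) * (LaurentSTQ.t⁻¹ : LaurentSTQˣ) = 1 := Units.mul_inv _
  have hq : (LaurentSTQ.q : LaurentSTQ) * (LaurentSTQ.q⁻¹ : LaurentSTQˣ) = 1 := Units.mul_inv _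
  rw [← mul_assoc, ← Units.val_mul, ← zpow_add]
  obtain ⟨c, e⟩ | x := p
  · by_cases hl : a = .inl (c, .left)
    · subst hl
      cases hk : D.kind c <;> cases e <;>
        simp [label, biquandleRule, hk, Fox.evalDeriv_mul, Fox.evalDeriv_inv, Fox.evalDeriv_of,
          abel, hh.next_left, hh.next_right, hh.right, toSTQ_s, toSTQ_t, toSTQ_t_inv]
      all_goals grind
    · by_cases hr : a = .inl (c, .right)
      · subst hr
        cases hk : D.kind c <;> cases e <;>
          simp [label, biquandleRule, hk, Fox.evalDeriv_mul, Fox.evalDeriv_inv, Fox.evalDeriv_of,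
            abel, hh.next_left, hh.next_right, hh.right, toSTQ_t, toSTQ_s_inv, toSTQ_t_inv]
        all_goals grind
      · have hl' := Ne.symm hl
        have hr' := Ne.symm hr
        cases hk : D.kind c <;> cases e <;>
          simp [label, biquandleRule, hk, Fox.evalDeriv_mul, Fox.evalDeriv_inv, Fox.evalDeriv_of,
            abel, hl', hr', hl, hr]
  · by_cases ha : a = .inr x
    · subst ha
      simp [label, biquandleRule, Fox.evalDeriv_of, hh.next_point]
    · simp [label, biquandleRule, Fox.evalDeriv_of, ha, Ne.symm ha]

theorem IsAlexanderNumbering.arcMatrix_apply {h : D.Port → ℤ} (hh : D.IsAlexanderNumbering h)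
    (p a : D.Port) :
    D.arcMatrix p a = (LaurentSTQ.q ^ h (D.next p) : LaurentSTQˣ) *
      ((LaurentSTQ.q ^ (-h a) : LaurentSTQˣ) * toSTQ (D.biquandleMatrix p a)) := by
  rw [arcMatrix, Matrix.of_apply, evalDeriv_relator_inl, hh.evalDeriv_label, Fox.evalDeriv_of,
    biquandleMatrix, Matrix.of_apply, Pi.sub_apply, map_sub, mul_sub, mul_sub]
  congr 1
  by_cases ha : D.next p = a
  · subst ha
    simp
  · simp [ha, Ne.symm ha]

theorem IsAlexanderNumbering.det_arcMatrix {h : D.Port → ℤ} (hh : D.IsAlexanderNumbering h) :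
    D.arcMatrix.det = toSTQ D.biquandleMatrix.det := by
  have hM : D.arcMatrix = Matrix.of fun p a =>
      ((LaurentSTQ.q ^ h (D.next p) : LaurentSTQˣ) : LaurentSTQ) *
        Matrix.of (fun p a => ((LaurentSTQ.q ^ (-h a) : LaurentSTQˣ) : LaurentSTQ) *
          (toSTQ.mapMatrix D.biquandleMatrix) p a) p a := by
    ext p a : 1
    exact hh.arcMatrix_apply p a
  rw [hM, Matrix.det_mul_column, Matrix.det_mul_row, ← RingHom.map_det, ← mul_assoc,
    Equiv.prod_comp D.next fun a => ((LaurentSTQ.q ^ h a : LaurentSTQˣ) : LaurentSTQ),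
    ← Finset.prod_mul_distrib]
  simp [← Units.val_mul]

theorem IsPlanar.det_arcMatrix (hD : D.IsPlanar) :
    D.arcMatrix.det = toSTQ D.biquandleMatrix.det :=
  hD.exists_isAlexanderNumbering.elim fun _ hh => hh.det_arcMatrix

end Diagram

/-! ### Relation matrices, isomorphisms and marked points -/

/-- The coefficient of the arc entering a crossing on the side `b` in the biquandle rule for the arc
leaving it on the side `a`. -/
def CrossingKind.coeff : CrossingKind → Side → Side → LaurentST
  | .pos, .left, .left => 1 - (LaurentST.s : LaurentST) * LaurentST.t
  | .pos, .left, .right => LaurentST.t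
  | .pos, .right, .left => LaurentST.s
  | .pos, .right, .right => 0
  | .neg, .left, .left => 0
  | .neg, .left, .right => (LaurentST.s⁻¹ : LaurentSTˣ)
  | .neg, .right, .left => (LaurentST.t⁻¹ : LaurentSTˣ)
  | .neg, .right, .right => 1 - (LaurentST.s⁻¹ : LaurentSTˣ) * (LaurentST.t⁻¹ : LaurentSTˣ)
  | .virt, .left, .left => 0
  | .virt, .left, .right => 1
  | .virt, .right, .left => 1
  | .virt, .right, .right => 0

/-- The matrix of the biquandle rules at crossings `C` and marked points `P`. -/
def vertexMatrix {C P : Type} [DecidableEq C] [DecidableEq P] (kind : C → CrossingKind) :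
    Matrix ((C × Side) ⊕ P) ((C × Side) ⊕ P) LaurentST :=
  Matrix.fromBlocks
    (Matrix.of fun x y => if x.1 = y.1 then (kind x.1).coeff x.2 y.2 else 0) 0 0 1

/-- The matrix of a map, sending the `i`-th basis row vector to the `f i`-th one. -/
def mapMatrix {I J : Type} [DecidableEq J] (f : I → J) : Matrix I J LaurentST :=
  Matrix.of fun i j => if f i = j then 1 else 0

/-- Reindexing of `mapMatrix` along a commutative square of maps. -/
theorem mapMatrix_apply_of_comm {I J I' J' : Type} [DecidableEq J] [DecidableEq J'] {n : I → J}
    {n' : I' → J'} (e : I' → I) (f : J' ≃ J) (h : ∀ i, n (e i) = f (n' i)) (i : I') (j : J') :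
    mapMatrix n (e i) (f j) = mapMatrix n' i j := by
  simp only [mapMatrix, Matrix.of_apply, h, f.injective.eq_iff]

theorem vertexMatrix_sumAssoc {C P Q : Type} [DecidableEq C] [DecidableEq P] [DecidableEq Q]
    (kind : C → CrossingKind) (i j : ((C × Side) ⊕ P) ⊕ Q) :
    vertexMatrix kind (Equiv.sumAssoc _ _ _ i) (Equiv.sumAssoc _ _ _ j) =
      Matrix.fromBlocks (vertexMatrix kind) 0 0 1 i j := by
  obtain (⟨c, a⟩ | x) | u := i <;> obtain (⟨d, b⟩ | y) | v := j <;>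
    simp [vertexMatrix, Matrix.one_apply]

theorem Diagram.biquandleMatrix_eq (D : Diagram) :
    D.biquandleMatrix = mapMatrix D.next - vertexMatrix D.kind := by
  ext p q : 1
  rw [biquandleMatrix, Matrix.of_apply, Pi.sub_apply, Matrix.sub_apply]
  congr 1
  · simp [mapMatrix, Pi.single_apply, eq_comm]
  · obtain ⟨c, a⟩ | x := p <;> obtain ⟨d, b⟩ | y := q
    · by_cases hcd : c = d
      · subst hcd
        cases hk : D.kind c <;> cases a <;> cases b <;>
          simp [biquandleRule, vertexMatrix, CrossingKind.coeff, hk]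
      · have hcd' := Ne.symm hcd
        cases hk : D.kind c <;> cases a <;> cases b <;>
          simp [biquandleRule, vertexMatrix, CrossingKind.coeff, hk, hcd, hcd']
    · cases hk : D.kind c <;> cases a <;> simp [biquandleRule, vertexMatrix, hk]
    · simp [biquandleRule, vertexMatrix]
    · simp [biquandleRule, vertexMatrix, Pi.single_apply, Matrix.one_apply, eq_comm]

/-- Reindexing rows and columns independently changes the determinant at most by a sign. -/
theorem Matrix.associated_det_submatrix {I J R : Type} [Fintype I] [DecidableEq I] [Fintype J]
    [DecidableEq J] [CommRing R] (M : Matrix J J R) (e f : I ≃ J) :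
    Associated (M.submatrix e f).det M.det := by
  have h : M.submatrix e f = (M.submatrix e e).submatrix id (f.trans e.symm) := by
    ext i j
    simp
  rw [h, det_permute', det_submatrix_equiv_self]
  obtain hs | hs := Int.units_eq_one_or (Equiv.Perm.sign (f.trans e.symm)) <;> rw [hs]
  · simp
  · simp

namespace Diagram

theorem Iso.associated_det {D E : Diagram} (h : D.Iso E) :
    Associated D.biquandleMatrix.det E.biquandleMatrix.det := by
  obtain ⟨c, x, hk, hn⟩ := h
  let e : D.Port ≃ E.Port := Equiv.sumCongr (Equiv.prodCongr c (Equiv.refl Side)) x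
  have he (p : D.Port) : E.next (e p) = e (D.next p) := hn p
  have hM : D.biquandleMatrix = E.biquandleMatrix.submatrix e e := by
    rw [biquandleMatrix_eq, biquandleMatrix_eq]
    ext p q : 1
    simp only [Matrix.submatrix_apply, Matrix.sub_apply]
    congr 1
    · simp [mapMatrix, he]
    · obtain ⟨c, a⟩ | x := p <;> obtain ⟨d, b⟩ | y := q <;>
        simp [vertexMatrix, e, hk, Matrix.one_apply]
  rw [hM]
  exact Matrix.associated_det_submatrix _ _ _

/-- Eliminating the arc that terminates at the new marked point gives back the original matrix. -/
theorem associated_det_subdivide (D : Diagram) (p : D.Port) :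
    Associated D.biquandleMatrix.det (D.subdivide p).biquandleMatrix.det := by
  let e : D.Port ⊕ Unit ≃ (D.subdivide p).Port := Equiv.sumAssoc _ _ _
  refine Associated.trans ?_ (Matrix.associated_det_submatrix _ e e)
  let A : Matrix D.Port D.Port LaurentST :=
    (Matrix.of fun a b => if a = p then 0 else if D.next a = b then 1 else 0) - vertexMatrix D.kind
  let B : Matrix D.Port Unit LaurentST := Matrix.of fun a _ => if a = p then 1 else 0
  let C : Matrix Unit D.Port LaurentST := Matrix.of fun _ b => if D.next p = b then 1 else 0
  have hn (i : D.Port ⊕ Unit) : (D.subdivide p).next (e i) =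
      e (Equiv.sumCongr D.next (Equiv.refl Unit) (Equiv.swap (.inl p) (.inr ()) i)) := by
    obtain (⟨c, a⟩ | x) | u := i <;> rfl
  have hM : (D.subdivide p).biquandleMatrix.submatrix e e = Matrix.fromBlocks A B C (-1) := by
    rw [biquandleMatrix_eq]
    ext i j : 1
    rw [Matrix.submatrix_apply, Matrix.sub_apply]
    have h2 : vertexMatrix (D.subdivide p).kind (e i) (e j) =
        Matrix.fromBlocks (vertexMatrix D.kind) 0 0 (1 : Matrix Unit Unit LaurentST) i j := by
      exact vertexMatrix_sumAssoc D.kind i j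
    refine (congrArg₂ (· - ·) (mapMatrix_apply_of_comm e e hn i j) h2).trans ?_
    simp only [mapMatrix, Matrix.of_apply]
    obtain a | u := i
    · by_cases ha : a = p
      · subst ha
        obtain b | v := j <;> simp [A, B]
      · have hs : Equiv.swap (Sum.inl p) (Sum.inr ()) (Sum.inl a) = Sum.inl a :=
          Equiv.swap_apply_of_ne_of_ne (by simpa using ha) (by simp)
        obtain b | v := j <;> simp [A, B, ha, hs]
    · obtain b | v := j <;> simp [C]
  have hD : D.biquandleMatrix = A + B * C := by
    rw [biquandleMatrix_eq]
    ext a b : 1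
    by_cases ha : a = p <;> simp [A, B, C, mapMatrix, Matrix.mul_apply, ha, neg_add_eq_sub]
  let inv : Invertible (-1 : Matrix Unit Unit LaurentST) := ⟨-1, by simp, by simp⟩
  have hinv : ⅟(-1 : Matrix Unit Unit LaurentST) = -1 := rfl
  rw [hM, Matrix.det_fromBlocks₂₂, hinv, hD]
  simp

end Diagram

/-! ### Gluing and elimination of tangles -/

namespace Tangle

variable {m : ℕ}

/-- The arc ends of a tangle other than the boundary ends. -/
abbrev Port (T : Tangle m) : Type := (T.Crossing × Side) ⊕ T.Point

/-- The relation matrix of a tangle, without the terms of the arcs that start at the boundary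
outside the tangle: rows are indexed by the ends at which arcs start, columns by those at which they
terminate. -/
def biquandleMatrix (T : Tangle m) : Matrix (T.Port ⊕ Fin m) (T.Port ⊕ Fin m) LaurentST :=
  mapMatrix T.next - Matrix.fromBlocks (vertexMatrix T.kind) 0 0 0

/-- The matrix that identifies the boundary of one tangle with that of another one. -/
def boundaryMatrix (I J : Type) (m : ℕ) : Matrix (I ⊕ Fin m) (J ⊕ Fin m) LaurentST :=
  Matrix.fromBlocks 0 0 0 1

theorem vertexMatrix_glueEquiv {C P C' P' : Type} [DecidableEq C] [DecidableEq P]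
    [DecidableEq C'] [DecidableEq P'] (kind : C → CrossingKind) (kind' : C' → CrossingKind)
    (i j : (((C × Side) ⊕ P) ⊕ Fin m) ⊕ (((C' × Side) ⊕ P') ⊕ Fin m)) :
    vertexMatrix (Sum.elim kind kind') ((glueEquiv C P C' P' _ _).symm i)
        (Equiv.sumCongr (Equiv.refl _) (Equiv.sumCongr (Equiv.refl _) (Equiv.sumComm _ _))
          ((glueEquiv C P C' P' _ _).symm j)) =
      Matrix.fromBlocks (Matrix.fromBlocks (vertexMatrix kind) 0 0 0) (boundaryMatrix _ _ m)
        (boundaryMatrix _ _ m) (Matrix.fromBlocks (vertexMatrix kind') 0 0 0) i j := by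
  obtain ((⟨c, a⟩ | x) | k) | ((⟨c, a⟩ | x) | k) := i <;>
    obtain ((⟨d, b⟩ | y) | l) | ((⟨d, b⟩ | y) | l) := j <;>
    simp [glueEquiv, vertexMatrix, boundaryMatrix, Matrix.one_apply]

/-- Up to reindexing, the matrix of a glued diagram has the matrices of the two tangles as diagonal
blocks.  The columns are not indexed like the rows: a boundary end at which arcs of one tangle
terminate is an end at which arcs of the other one start. -/
theorem associated_det_glue (T R : Tangle m) :
    Associated (T.glue R).biquandleMatrix.det
      (Matrix.fromBlocks T.biquandleMatrix (-boundaryMatrix _ _ m) (-boundaryMatrix _ _ m)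
        R.biquandleMatrix).det := by
  let e : (T.Port ⊕ Fin m) ⊕ (R.Port ⊕ Fin m) ≃ (T.glue R).Port :=
    (glueEquiv T.Crossing T.Point R.Crossing R.Point (Fin m) (Fin m)).symm
  let f : (T.Port ⊕ Fin m) ⊕ (R.Port ⊕ Fin m) ≃ (T.glue R).Port :=
    e.trans (Equiv.sumCongr (Equiv.refl _)
      (Equiv.sumCongr (Equiv.refl _) (Equiv.sumComm (Fin m) (Fin m))))
  have hf (i : (T.Port ⊕ Fin m) ⊕ (R.Port ⊕ Fin m)) :
      (T.glue R).next (e i) = f (Equiv.sumCongr T.next R.next i) := by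
    refine congrArg f (congrArg (Equiv.sumCongr T.next R.next) ?_)
    exact Equiv.apply_symm_apply _ _
  have h : Matrix.fromBlocks T.biquandleMatrix (-boundaryMatrix _ _ m)
      (-boundaryMatrix _ _ m) R.biquandleMatrix = (T.glue R).biquandleMatrix.submatrix e f := by
    rw [Diagram.biquandleMatrix_eq]
    refine Matrix.ext fun i j => Eq.symm ?_
    refine (congrArg₂ (· - ·) (mapMatrix_apply_of_comm e f hf i j)
      (vertexMatrix_glueEquiv T.kind R.kind i j)).trans ?_
    obtain i | i := i <;> obtain j | j := j <;>
      simp [biquandleMatrix, mapMatrix]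
  rw [h]
  exact (Matrix.associated_det_submatrix _ _ _).symm

/-- In a glued diagram, a tangle with an invertible relation matrix can be eliminated.  What remains
depends only on the block of the inverse matrix that expresses the outgoing boundary labels by the
incoming ones. -/
theorem associated_det_glue_of_toBlocks₂₂_eq (T T' R : Tangle m) (hT : IsUnit T.biquandleMatrix.det)
    (hT' : IsUnit T'.biquandleMatrix.det)
    (h : T.biquandleMatrix⁻¹.toBlocks₂₂ = T'.biquandleMatrix⁻¹.toBlocks₂₂) :
    Associated (T.glue R).biquandleMatrix.det (T'.glue R).biquandleMatrix.det := by
  have key (T : Tangle m) (hT : IsUnit T.biquandleMatrix.det) :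
      Associated (T.glue R).biquandleMatrix.det (R.biquandleMatrix -
        Matrix.fromBlocks 0 0 0 T.biquandleMatrix⁻¹.toBlocks₂₂).det := by
    refine (associated_det_glue T R).trans ?_
    have := T.biquandleMatrix.invertibleOfIsUnitDet hT
    have hB : (-boundaryMatrix R.Port T.Port m) * T.biquandleMatrix⁻¹ *
        (-boundaryMatrix T.Port R.Port m) =
        Matrix.fromBlocks 0 0 0 T.biquandleMatrix⁻¹.toBlocks₂₂ := by
      rw [← Matrix.fromBlocks_toBlocks T.biquandleMatrix⁻¹]
      simp [boundaryMatrix, Matrix.fromBlocks_multiply]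
    rw [Matrix.det_fromBlocks₁₁, Matrix.invOf_eq_nonsing_inv, hB]
    exact associated_unit_mul_left _ _ hT
  exact (h ▸ key T hT).trans (key T' hT').symm

/-- The right hand sides of the biquandle rules at the crossings of a tangle without marked points,
for a labelling `x` of its arcs. -/
def ruleValue {n : ℕ} (kind : Fin n → CrossingKind) (x : (Fin n × Side) ⊕ Fin m → LaurentST) :
    (Fin n × Side) ⊕ Fin m → LaurentST
  | .inl (c, a) => (kind c).coeff a .left * x (.inl (c, .left)) +
      (kind c).coeff a .right * x (.inl (c, .right))
  | .inr _ => 0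

/-- `sol` solves the inhomogeneous linear system of the biquandle rules of a tangle without marked
points. -/
def IsSolver {n : ℕ} (kind : Fin n → CrossingKind)
    (next : (Fin n × Side) ⊕ Fin m → (Fin n × Side) ⊕ Fin m)
    (sol : ((Fin n × Side) ⊕ Fin m → LaurentST) → ((Fin n × Side) ⊕ Fin m → LaurentST)) : Prop :=
  ∀ y i, sol y (next i) = ruleValue kind (sol y) i + y i

theorem sum_side {M : Type} [AddCommMonoid M] (f : Side → M) : ∑ a, f a = f .left + f .right :=
  Finset.sum_pair (by decide)

/-- The relation matrix of a tangle without marked points. -/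
def nextMatrix {n : ℕ} (kind : Fin n → CrossingKind)
    (next : (Fin n × Side) ⊕ Fin m → (Fin n × Side) ⊕ Fin m) :
    Matrix ((Fin n × Side) ⊕ Fin m) ((Fin n × Side) ⊕ Fin m) LaurentST :=
  mapMatrix next - Matrix.fromBlocks
    (Matrix.of fun x y => if x.1 = y.1 then (kind x.1).coeff x.2 y.2 else 0) 0 0 0

/-- The indices of the relation matrix of a tangle without marked points. -/
def ofNextEquiv {n : ℕ} (kind : Fin n → CrossingKind)
    (next : (Fin n × Side) ⊕ Fin m → (Fin n × Side) ⊕ Fin m) (h : Function.Bijective next) :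
    (Fin n × Side) ⊕ Fin m ≃ (ofNext kind next h).Port ⊕ Fin m :=
  (Equiv.sumCongr (Equiv.sumEmpty (Fin n × Side) Empty) (Equiv.refl _)).symm

theorem biquandleMatrix_ofNext {n : ℕ} (kind : Fin n → CrossingKind)
    (next : (Fin n × Side) ⊕ Fin m → (Fin n × Side) ⊕ Fin m) (h : Function.Bijective next) :
    (ofNext kind next h).biquandleMatrix.submatrix (ofNextEquiv kind next h)
      (ofNextEquiv kind next h) = nextMatrix kind next := by
  refine Matrix.ext fun i j => ?_
  refine congrArg₂ (· - ·) (mapMatrix_apply_of_comm (ofNextEquiv kind next h)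
    (ofNextEquiv kind next h) (n' := next) (fun i => ?_) i j) ?_
  · exact congrArg (fun i => ofNextEquiv kind next h (next i))
      ((ofNextEquiv kind next h).symm_apply_apply i)
  · obtain ⟨c, a⟩ | k := i <;> obtain ⟨d, b⟩ | l := j <;> rfl

theorem IsSolver.mulVec {n : ℕ} {kind : Fin n → CrossingKind}
    {next : (Fin n × Side) ⊕ Fin m → (Fin n × Side) ⊕ Fin m}
    {sol : ((Fin n × Side) ⊕ Fin m → LaurentST) → ((Fin n × Side) ⊕ Fin m → LaurentST)}
    (hs : IsSolver kind next sol) (y : (Fin n × Side) ⊕ Fin m → LaurentST) :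
    nextMatrix kind next *ᵥ sol y = y := by
  rw [nextMatrix, Matrix.sub_mulVec]
  funext i
  have h1 : (mapMatrix next *ᵥ sol y) i = sol y (next i) := by
    simp [mapMatrix, Matrix.mulVec, dotProduct]
  rw [Pi.sub_apply, h1, hs y i, sub_eq_iff_eq_add, add_comm]
  congr 1
  obtain ⟨c, a⟩ | k := i
  · simp [Matrix.mulVec, dotProduct, ruleValue, Fintype.sum_prod_type, sum_side]
  · simp [Matrix.mulVec, dotProduct, ruleValue]

theorem IsSolver.isUnit_det {n : ℕ} {kind : Fin n → CrossingKind}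
    {next : (Fin n × Side) ⊕ Fin m → (Fin n × Side) ⊕ Fin m}
    {sol : ((Fin n × Side) ⊕ Fin m → LaurentST) → ((Fin n × Side) ⊕ Fin m → LaurentST)}
    (hs : IsSolver kind next sol) : IsUnit (nextMatrix kind next).det := by
  rw [← Matrix.isUnit_iff_isUnit_det]
  exact Matrix.mulVec_surjective_iff_isUnit.mp fun y => ⟨sol y, hs.mulVec y⟩

theorem IsSolver.inv_apply {n : ℕ} {kind : Fin n → CrossingKind}
    {next : (Fin n × Side) ⊕ Fin m → (Fin n × Side) ⊕ Fin m}
    {sol : ((Fin n × Side) ⊕ Fin m → LaurentST) → ((Fin n × Side) ⊕ Fin m → LaurentST)}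
    (hs : IsSolver kind next sol) (j k : Fin m) :
    (nextMatrix kind next)⁻¹ (.inr j) (.inr k) = sol (Sum.elim 0 (Pi.single k 1)) (.inr j) := by
  have h1 : (Pi.single (.inr k) 1 : (Fin n × Side) ⊕ Fin m → LaurentST) =
      Sum.elim (0 : Fin n × Side → LaurentST) (Pi.single k 1) := by
    funext i
    obtain x | l := i <;> simp [Pi.single_apply]
  have h2 := congrArg ((nextMatrix kind next)⁻¹ *ᵥ ·) (hs.mulVec (Sum.elim 0 (Pi.single k 1)))
  simp only [Matrix.mulVec_mulVec, Matrix.nonsing_inv_mul _ hs.isUnit_det, Matrix.one_mulVec] at h2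
  rw [h2, ← h1, Matrix.mulVec_single_one]
  rfl

/-- Two tangles without marked points, in which every labelling of the incoming boundary extends
uniquely to the tangle and gives the same labelling of the outgoing boundary, can be exchanged. -/
theorem associated_det_glue_ofNext {n n' : ℕ} {kind : Fin n → CrossingKind}
    {next : (Fin n × Side) ⊕ Fin m → (Fin n × Side) ⊕ Fin m}
    {sol : ((Fin n × Side) ⊕ Fin m → LaurentST) → ((Fin n × Side) ⊕ Fin m → LaurentST)}
    {kind' : Fin n' → CrossingKind}
    {next' : (Fin n' × Side) ⊕ Fin m → (Fin n' × Side) ⊕ Fin m}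
    {sol' : ((Fin n' × Side) ⊕ Fin m → LaurentST) → ((Fin n' × Side) ⊕ Fin m → LaurentST)}
    (h : Function.Bijective next) (h' : Function.Bijective next')
    (hs : IsSolver kind next sol) (hs' : IsSolver kind' next' sol')
    (hout : ∀ b j, sol (Sum.elim 0 b) (.inr j) = sol' (Sum.elim 0 b) (.inr j)) (R : Tangle m) :
    Associated ((ofNext kind next h).glue R).biquandleMatrix.det
      ((ofNext kind' next' h').glue R).biquandleMatrix.det := by
  have hdet {n : ℕ} {kind : Fin n → CrossingKind} {next} (h : Function.Bijective next) {sol}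
      (hs : IsSolver (m := m) kind next sol) : IsUnit (ofNext kind next h).biquandleMatrix.det := by
    rw [← Matrix.det_submatrix_equiv_self (ofNextEquiv kind next h), biquandleMatrix_ofNext]
    exact hs.isUnit_det
  have hinv {n : ℕ} {kind : Fin n → CrossingKind} {next} (h : Function.Bijective next) {sol}
      (hs : IsSolver (m := m) kind next sol) (j k : Fin m) :
      (ofNext kind next h).biquandleMatrix⁻¹.toBlocks₂₂ j k =
        sol (Sum.elim 0 (Pi.single k 1)) (.inr j) := by
    rw [← hs.inv_apply, ← biquandleMatrix_ofNext kind next h, Matrix.inv_submatrix_equiv]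
    rfl
  refine associated_det_glue_of_toBlocks₂₂_eq _ _ R (hdet h hs) (hdet h' hs') ?_
  refine Matrix.ext fun j k => ?_
  rw [hinv h hs, hinv h' hs', hout]

end Tangle

/-! ### Invariance under the generalized Reidemeister moves -/

namespace CrossingKind

/-- At most one of two opposite crossings reflects labels on the side `a`; hence, for
antiparallel strands, the label of a side of the bigon between them does not depend on itself. -/
theorem coeff_mul_coeff_opp (k : CrossingKind) (a : Side) : k.coeff a a * k.opp.coeff a a = 0 := by
  cases k <;> cases a <;> simp [coeff, opp]

/-- The inverse of `1 - k.coeff a a`, which is a unit. -/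
def loopInv : CrossingKind → Side → LaurentST
  | .pos, .left => (LaurentST.s⁻¹ : LaurentSTˣ) * (LaurentST.t⁻¹ : LaurentSTˣ)
  | .neg, .right => LaurentST.s * LaurentST.t
  | _, _ => 1

theorem s_mul_inv : (LaurentST.s : LaurentST) * (LaurentST.s⁻¹ : LaurentSTˣ) = 1 := Units.mul_inv _
theorem t_mul_inv : (LaurentST.t : LaurentST) * (LaurentST.t⁻¹ : LaurentSTˣ) = 1 := Units.mul_inv _

theorem loopInv_mul (k : CrossingKind) (a : Side) : k.loopInv a * (1 - k.coeff a a) = 1 := by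
  have hs := s_mul_inv
  have ht := t_mul_inv
  cases k <;> cases a <;> simp [coeff, loopInv]
  all_goals grind

/-- A curl on the side `a` passes labels on unchanged. -/
theorem coeff_loop (k : CrossingKind) (a : Side) :
    k.coeff a.other a * k.loopInv a * k.coeff a a.other + k.coeff a.other a.other = 1 := by
  have hs := s_mul_inv
  have ht := t_mul_inv
  cases k <;> cases a <;> simp [coeff, loopInv, Side.other]
  all_goals grind

/-- The rules of opposite crossings are inverse to each other. -/
theorem coeff_parallel (k : CrossingKind) (a b : Side) :
    k.opp.coeff a .left * k.coeff .left b + k.opp.coeff a .right * k.coeff .right b =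
      if a = b then 1 else 0 := by
  have hs := s_mul_inv
  have ht := t_mul_inv
  cases k <;> cases a <;> cases b <;> simp [coeff, opp]
  all_goals grind

/-- The rules of opposite crossings are also inverse to each other when read sideways: the label of
a strand is passed on, and the other strand does not contribute. -/
theorem coeff_antiparallel (k : CrossingKind) (a : Side) :
    k.opp.coeff a.other a * k.coeff a a.other = 1 ∧
    k.opp.coeff a.other a * k.coeff a a * k.opp.coeff a a.other +
      k.opp.coeff a.other a.other = 0 := by
  have hs := s_mul_inv
  have ht := t_mul_inv
  cases k <;> cases a <;> simp [coeff, opp, Side.other]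
  all_goals grind

theorem opp_opp (k : CrossingKind) : k.opp.opp = k := by cases k <;> rfl

end CrossingKind

namespace Tangle

/-- Without crossings, the labels are the given right hand sides. -/
theorem isSolver_strands (m : ℕ) : IsSolver (m := m) Fin.elim0 id id := by
  rintro y (⟨c, a⟩ | k)
  · exact c.elim0
  · exact (zero_add _).symm

theorem associated_det_curl (k : CrossingKind) (a : Side) (R : Tangle 1) :
    Associated ((strands 1).glue R).biquandleMatrix.det
      ((curl k a).glue R).biquandleMatrix.det := by
  refine associated_det_glue_ofNext (sol' := fun y =>
    let x := k.loopInv a * (k.coeff a a.other * y (.inr 0) + y (.inl (0, a)))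
    Sum.elim (fun p => if p.2 = a then x else y (.inr 0))
      (fun _ => k.coeff a.other a * x + k.coeff a.other a.other * y (.inr 0) +
        y (.inl (0, a.other)))) _ _ (isSolver_strands 1) ?_ ?_ R
  · have h := k.loopInv_mul a
    rintro y (⟨c, b⟩ | j)
    · fin_cases c
      cases a <;> cases b <;> simp [ruleValue, Side.other] at h ⊢
      all_goals grind
    · fin_cases j
      cases a <;> simp [ruleValue, Side.other]
  · intro b j
    fin_cases j
    have h := k.coeff_loop a
    simp
    linear_combination (-b 0) * h

theorem associated_det_parallelBigon (k : CrossingKind) (R : Tangle 2) :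
    Associated ((strands 2).glue R).biquandleMatrix.det
      ((parallelBigon k).glue R).biquandleMatrix.det := by
  refine associated_det_glue_ofNext (m := 2) (n' := 2) (sol' := fun y =>
    let x (a : Side) := k.coeff a .left * y (.inr 0) + k.coeff a .right * y (.inr 1) +
      y (.inl (0, a))
    let z (a : Side) := k.opp.coeff a .left * x .left + k.opp.coeff a .right * x .right +
      y (.inl (1, a))
    fun
      | .inl (0, .left) => y (.inr 0)
      | .inl (0, .right) => y (.inr 1)
      | .inl (1, a) => x a
      | .inr 0 => z .left
      | .inr 1 => z .right) _ _ (isSolver_strands 2) ?_ ?_ R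
  · rintro y (⟨c, b⟩ | j)
    · fin_cases c <;> cases b <;> rfl
    · fin_cases j <;> exact (zero_add _).symm
  · intro b j
    have h1 := k.coeff_parallel .left
    have h2 := k.coeff_parallel .right
    fin_cases j <;> simp
    · linear_combination (-b 0) * (h1 .left).trans (if_pos rfl) -
        b 1 * (h1 .right).trans (if_neg nofun)
    · linear_combination (-b 0) * (h2 .left).trans (if_neg nofun) -
        b 1 * (h2 .right).trans (if_pos rfl)

theorem associated_det_antiparallelBigon (k : CrossingKind) (a : Side) (R : Tangle 2) :
    Associated ((strands 2).glue R).biquandleMatrix.det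
      ((antiparallelBigon k a).glue R).biquandleMatrix.det := by
  refine associated_det_glue_ofNext (m := 2) (n' := 2) (sol' := fun y =>
    -- `x` and `z` are the labels of the two sides of the bigon.
    let d := k.coeff a a.other * y (.inr 0) + y (.inl (0, a))
    let e := k.opp.coeff a a.other * y (.inr 1) + y (.inl (1, a))
    let x := k.opp.coeff a a * d + e
    let z := k.coeff a a * e + d
    fun
      | .inl (0, b) => if b = a then x else y (.inr 0)
      | .inl (1, b) => if b = a then z else y (.inr 1)
      | .inr 0 => k.opp.coeff a.other a * z + k.opp.coeff a.other a.other * y (.inr 1) +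
          y (.inl (1, a.other))
      | .inr 1 => k.coeff a.other a * x + k.coeff a.other a.other * y (.inr 0) +
          y (.inl (0, a.other))) _ _ (isSolver_strands 2) ?_ ?_ R
  · have h := k.coeff_mul_coeff_opp a
    rintro y (⟨c, b⟩ | j)
    · fin_cases c <;> cases a <;> cases b <;> simp [ruleValue, Side.other] at h ⊢
      all_goals grind
    · fin_cases j <;> cases a <;> simp [ruleValue, Side.other]
  · intro b j
    obtain ⟨h1, h2⟩ := k.coeff_antiparallel a
    obtain ⟨h3, h4⟩ := k.opp.coeff_antiparallel a
    rw [CrossingKind.opp_opp] at h3 h4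
    fin_cases j <;> simp
    · linear_combination (- b 0) * h1 - b 1 * h2
    · linear_combination (- b 1) * h3 - b 0 * h4

theorem associated_det_braidTriangle (k : Fin 3 → CrossingKind)
    (h : CrossingKind.Triangle (k 0) (k 2) (k 1).opp) (R : Tangle 3) :
    Associated ((braidTriangleLeft k).glue R).biquandleMatrix.det
      ((braidTriangleRight k).glue R).biquandleMatrix.det := by
  refine associated_det_glue_ofNext (m := 3) (n := 3) (n' := 3) (sol := fun y =>
    let x₀ (a : Side) := (k 0).coeff a .left * y (.inr 0) + (k 0).coeff a .right * y (.inr 1) +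
      y (.inl (0, a))
    let x₁ (a : Side) := (k 1).coeff a .left * x₀ .right + (k 1).coeff a .right * y (.inr 2) +
      y (.inl (1, a))
    let x₂ (a : Side) := (k 2).coeff a .left * x₀ .left + (k 2).coeff a .right * x₁ .left +
      y (.inl (2, a))
    fun
      | .inl (0, .left) => y (.inr 0)
      | .inl (0, .right) => y (.inr 1)
      | .inl (1, .left) => x₀ .right
      | .inl (1, .right) => y (.inr 2)
      | .inl (2, .left) => x₀ .left
      | .inl (2, .right) => x₁ .left
      | .inr 0 => x₂ .left
      | .inr 1 => x₂ .right
      | .inr 2 => x₁ .right) (sol' := fun y =>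
    let x₂ (a : Side) := (k 2).coeff a .left * y (.inr 1) + (k 2).coeff a .right * y (.inr 2) +
      y (.inl (2, a))
    let x₁ (a : Side) := (k 1).coeff a .left * y (.inr 0) + (k 1).coeff a .right * x₂ .left +
      y (.inl (1, a))
    let x₀ (a : Side) := (k 0).coeff a .left * x₁ .right + (k 0).coeff a .right * x₂ .right +
      y (.inl (0, a))
    fun
      | .inl (2, .left) => y (.inr 1)
      | .inl (2, .right) => y (.inr 2)
      | .inl (1, .left) => y (.inr 0)
      | .inl (1, .right) => x₂ .left
      | .inl (0, .left) => x₁ .right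
      | .inl (0, .right) => x₂ .right
      | .inr 0 => x₁ .left
      | .inr 1 => x₀ .left
      | .inr 2 => x₀ .right) _ _ ?_ ?_ ?_ R
  · rintro y (⟨c, b⟩ | j)
    · fin_cases c <;> cases b <;> rfl
    · fin_cases j <;> exact (zero_add _).symm
  · rintro y (⟨c, b⟩ | j)
    · fin_cases c <;> cases b <;> rfl
    · fin_cases j <;> exact (zero_add _).symm
  -- the Yang–Baxter equation, one case for each admissible triple of kinds
  · intro b j
    have hs := CrossingKind.s_mul_inv
    have ht := CrossingKind.t_mul_inv
    generalize k 0 = k₀, k 1 = k₁, k 2 = k₂ at *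
    cases k₀ <;> cases k₁ <;> cases k₂ <;> simp [CrossingKind.Triangle, CrossingKind.opp] at h <;>
      fin_cases j <;> simp [CrossingKind.coeff]
    all_goals grind

theorem associated_det_cyclicTriangle (k : Fin 3 → CrossingKind)
    (h : CrossingKind.Triangle (k 1) (k 2) (k 0)) (R : Tangle 3) :
    Associated ((cyclicTriangleLeft k).glue R).biquandleMatrix.det
      ((cyclicTriangleRight k).glue R).biquandleMatrix.det := by
  -- The three arcs around the triangle depend on each other cyclically.  The product
  -- of the coefficients is nonzero only if all crossings are positive (`hL`) or all are negative
  -- (`hR`), and these two cases are excluded.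
  have hL : (k 0).coeff .left .left * (k 1).coeff .left .left * (k 2).coeff .left .left = 0 := by
    generalize k 0 = k₀, k 1 = k₁, k 2 = k₂ at *
    cases k₀ <;> cases k₁ <;> cases k₂ <;> simp [CrossingKind.Triangle] at h <;>
      simp [CrossingKind.coeff]
  have hR : (k 0).coeff .right .right * (k 1).coeff .right .right * (k 2).coeff .right .right =
      0 := by
    generalize k 0 = k₀, k 1 = k₁, k 2 = k₂ at *
    cases k₀ <;> cases k₁ <;> cases k₂ <;> simp [CrossingKind.Triangle] at h <;>
      simp [CrossingKind.coeff]
  refine associated_det_glue_ofNext (m := 3) (n := 3) (n' := 3) (sol := fun y =>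
    -- `x i` is the side of the triangle that terminates at the crossing `i`.
    let d (i : Fin 3) := (k i).coeff .left .right * y (.inr i) + y (.inl (i, .left))
    let x (i : Fin 3) := d (i + 2) + (k (i + 2)).coeff .left .left *
      (d (i + 1) + (k (i + 1)).coeff .left .left * d i)
    fun
      | .inl (i, .left) => x i
      | .inl (i, .right) => y (.inr i)
      | .inr i => (k (i + 1)).coeff .right .left * x (i + 1) +
          (k (i + 1)).coeff .right .right * y (.inr (i + 1)) + y (.inl (i + 1, .right)))
    (sol' := fun y =>
    let d (i : Fin 3) := (k i).coeff .right .left * y (.inr (i + 2)) + y (.inl (i, .right))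
    let x (i : Fin 3) := d (i + 1) + (k (i + 1)).coeff .right .right *
      (d (i + 2) + (k (i + 2)).coeff .right .right * d i)
    fun
      | .inl (i, .left) => y (.inr (i + 2))
      | .inl (i, .right) => x i
      | .inr i => (k i).coeff .left .left * y (.inr (i + 2)) +
          (k i).coeff .left .right * x i + y (.inl (i, .left))) _ _ ?_ ?_ ?_ R
  · rintro y (⟨c, b⟩ | j)
    · fin_cases c <;> cases b <;> simp [ruleValue]
      all_goals grind
    · simp [ruleValue]
  · rintro y (⟨c, b⟩ | j)
    · fin_cases c <;> cases b <;> simp [ruleValue]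
      all_goals grind
    · fin_cases j <;> simp [ruleValue]
  · intro b j
    have hs := CrossingKind.s_mul_inv
    have ht := CrossingKind.t_mul_inv
    fin_cases j <;> simp <;> generalize k 0 = k₀, k 1 = k₁, k 2 = k₂ at * <;>
    cases k₀ <;> cases k₁ <;> cases k₂ <;> simp [CrossingKind.Triangle] at h <;>
      simp [CrossingKind.coeff]
    all_goals grind

end Tangle

theorem ReidemeisterMove.associated_det {m : ℕ} {T T' : Tangle m} (h : ReidemeisterMove T T')
    (R : Tangle m) :
    Associated (T.glue R).biquandleMatrix.det (T'.glue R).biquandleMatrix.det := by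
  cases h with
  | curl k a => exact Tangle.associated_det_curl k a R
  | parallelBigon k => exact Tangle.associated_det_parallelBigon k R
  | antiparallelBigon k a => exact Tangle.associated_det_antiparallelBigon k a R
  | braidTriangle k h => exact Tangle.associated_det_braidTriangle k h R
  | cyclicTriangle k h => exact Tangle.associated_det_cyclicTriangle k h R

theorem DiagramStep.associated_det {D E : Diagram} (h : DiagramStep D E) :
    Associated D.biquandleMatrix.det E.biquandleMatrix.det := by
  cases h with
  | iso h => exact h.associated_det
  | subdivide _ p => exact D.associated_det_subdivide p
  | move h R => exact h.associated_det R

/-! ### From diagrams to virtual links -/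

/-- The substitution `H(s, t, q) ↦ H(s, t, 1)`. -/
abbrev Diagram.toST : LaurentSTQ →+* LaurentST :=
  Laurent.subst ![LaurentST.s, LaurentST.t, 1]

theorem Diagram.toST_toSTQ (G : LaurentST) : toST (toSTQ G) = G := by
  have hs : toST (LaurentSTQ.s : LaurentSTQ) = LaurentST.s := Laurent.subst_X _ 0
  have ht : toST (LaurentSTQ.t : LaurentSTQ) = LaurentST.t := Laurent.subst_X _ 1
  have hq : toST (LaurentSTQ.q : LaurentSTQ) = 1 := Laurent.subst_X _ 2
  have hq' : toST (LaurentSTQ.q⁻¹ : LaurentSTQˣ) = 1 :=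
    (Laurent.subst_X_inv _ 2).trans (by simp)
  refine DFunLike.congr_fun (f := toST.comp toSTQ) (g := RingHom.id _)
    (Laurent.ringHom_ext fun i => ?_) G
  rw [RingHom.comp_apply, RingHom.id_apply]
  fin_cases i
  · exact (congrArg toST toSTQ_s).trans (by rw [map_mul, hs, hq', mul_one]; rfl)
  · exact (congrArg toST toSTQ_t).trans (by rw [map_mul, ht, hq, mul_one]; rfl)

namespace VirtualLink

open Diagram (toSTQ toST toST_toSTQ)

theorem associated_det_of_mk_eq {D E : VirtualLinkDiagram}
    (h : (Quot.mk _ D : VirtualLink) = Quot.mk _ E) :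
    Associated D.biquandleMatrix.det E.biquandleMatrix.det := by
  have h' := Quot.eqvGen_exact h
  clear h
  induction h' with
  | rel _ _ h => exact h.associated_det
  | refl => exact Associated.refl _
  | symm _ _ _ h => exact h.symm
  | trans _ _ _ _ _ h₁ h₂ => exact h₁.trans h₂

/-- Planarity compares the two polynomials of one diagram; passing to another diagram of the
link only requires the invariance of the generalized Alexander polynomial. -/
theorem associated_toSTQ {K : VirtualLink} {H : LaurentSTQ} {G : LaurentST}
    (hH : K.IsVirtualAlexanderPolynomial H) (hG : K.IsGeneralizedAlexanderPolynomial G) :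
    Associated H (toSTQ G) := by
  obtain ⟨D, rfl, hH⟩ := hH
  obtain ⟨E, hE, hG⟩ := hG
  have h1 := hH.associated D.isVirtualAlexanderPolynomial_det_arcMatrix
  rw [D.planar.det_arcMatrix] at h1
  exact h1.trans (((associated_det_of_mk_eq hE.symm).trans hG.symm).map toSTQ)

theorem associated_toST {K : VirtualLink} {H : LaurentSTQ} {G : LaurentST}
    (hH : K.IsVirtualAlexanderPolynomial H) (hG : K.IsGeneralizedAlexanderPolynomial G) :
    Associated G (toST H) := by
  have h := ((associated_toSTQ hH hG).map toST).symm
  rwa [toST_toSTQ] at h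

end VirtualLink

end

theorem mainTheorem4 (K : VirtualLink) :
    (∃ H : LaurentSTQ, K.IsVirtualAlexanderPolynomial H) ∧
    (∃ G : LaurentST, K.IsGeneralizedAlexanderPolynomial G) ∧
    (∀ (H : LaurentSTQ) (G : LaurentST),
      K.IsVirtualAlexanderPolynomial H → K.IsGeneralizedAlexanderPolynomial G →
        Associated H
          (Laurent.subst ![LaurentSTQ.s * LaurentSTQ.q⁻¹, LaurentSTQ.t * LaurentSTQ.q] G) ∧
        Associated G (Laurent.subst ![LaurentST.s, LaurentST.t, 1] H)) ∧
    (∀ (K' : VirtualLink) (H H' : LaurentSTQ) (G G' : LaurentST),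
      K.IsVirtualAlexanderPolynomial H → K'.IsVirtualAlexanderPolynomial H' →
      K.IsGeneralizedAlexanderPolynomial G → K'.IsGeneralizedAlexanderPolynomial G' →
        (Associated H H' ↔ Associated G G')) := by
  obtain ⟨D, hD⟩ := Quot.exists_rep K
  refine ⟨⟨_, D, hD, D.isVirtualAlexanderPolynomial_det_arcMatrix⟩, ⟨_, D, hD, Associated.refl _⟩,
    fun H G hH hG => ⟨VirtualLink.associated_toSTQ hH hG, VirtualLink.associated_toST hH hG⟩,
    fun K' H H' G G' hH hH' hG hG' => ⟨fun h => ?_, fun h => ?_⟩⟩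
  · exact (VirtualLink.associated_toST hH hG).trans
      ((h.map Diagram.toST).trans (VirtualLink.associated_toST hH' hG').symm)
  · exact (VirtualLink.associated_toSTQ hH hG).trans
      ((h.map Diagram.toSTQ).trans (VirtualLink.associated_toSTQ hH' hG').symm)
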